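/- Throughout, ``definable'' means definable with parameters. An interpretable set of a first-order structure $M$ is a quotient $X/E$ of a definable set $X\subseteq M^n$ by a definable equivalence relation $E$; definable subsets of such quotients, and definable maps between them, are those that lift to definable sets of tuples. A \emph{ranked group} (group of finite Morley rank) is a group $G$ carrying a first-order structure in which multiplication is definable and for which there is a function $\mathrm{rk}$ from the nonempty interpretable sets to $\mathbb{N}$ satisfying the Borovik--Poizat axioms: (i) $\mathrm{rk}(A)\ge n+1$ iff $A$ contains infinitely many pairwise disjoint nonempty definable subsets of rank $\ge n$; (ii) for every definable $f:A\to B$ and $n\in\mathbb N$, the set $\{b\in B: f^{-1}(b)\neq\emptyset,\ \mathrm{rk}(f^{-1}(b))=n\}$ is definable; (iii) if $f:A\to B$ is definable and surjective and all its fibres have rank $n$, then $\mathrm{rk}(A)=\mathrm{rk}(B)+n$; (iv) for every definable $f:A\to B$ there is $m\in\mathbb N$ such that every finite fibre of $f$ has at most $m$ elements. A subgroup of $G$ is \emph{connected} if it has no proper definable subgroup of finite index. A group $G$ with a proper subgroup $C$ is a \emph{quasi-Frobenius group} (written $C<G$) if $C$ has finite index in its normalizer $N_G(C)$ and $C^g\cap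 C=\{1\}$ for every $g\in G\setminus N_G(C)$, where $C^g=g^{-1}Cg$. \textbf{Proposition.} Let $C<G$ be a quasi-Frobenius group, where $G$ is a connected ranked group and $C$ is definable. Suppose that $G$ contains involutions (elements of order $2$) and that they all lie in $\bigcup_{g\in G}C^g$. Suppose that there is an infinite definable connected normal subgroup $A$ of $G$ with $A\cap C=\{1\}$. Then there is a definable connected abelian subgroup $A_1$ of $G$ such that $G=A_1\rtimes C$, that is, $A_1$ is normal in $G$, $A_1\cap C=\{1\}$ and $G=A_1C$. -/

import Mathlib

open FirstOrder

/-- A sort of imaginaries of the structure `M`: a definable (with parameters) equivalence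
relation on a cartesian power of `M`. -/
structure ImaginarySort (L : Language) (M : Type*) [L.Structure M] where
  /-- The exponent of the cartesian power. -/
  arity : ℕ
  /-- The equivalence relation. -/
  rel : Setoid (Fin arity → M)
  definable_rel : (Set.univ : Set M).Definable L
    {p : Fin arity ⊕ Fin arity → M | rel (p ∘ Sum.inl) (p ∘ Sum.inr)}

namespace ImaginarySort

variable {L : Language} {M : Type*} [L.Structure M]

/-- The elements of the sort `M ^ n / E`. -/
abbrev Point (s : ImaginarySort L M) : Type _ := Quotient s.rel

/-- The class of a tuple. -/
abbrev cls (s : ImaginarySort L M) (x : Fin s.arity → M) : s.Point := Quotient.mk s.rel x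

/-- Definable (with parameters) subsets of `M ^ n / E`. These are the interpretable sets of `M`:
a quotient `X / E` of a definable `X ⊆ M ^ n` by a definable equivalence relation `E` on `X` is
such a subset once `E` is extended to `M ^ n` by equality outside `X`. -/
def IsDefinable (s : ImaginarySort L M) (A : Set s.Point) : Prop :=
  (Set.univ : Set M).Definable L (s.cls ⁻¹' A)

/-- `f` restricts to a definable (with parameters) function from `A` to `B`;
the values of `f` outside `A` are irrelevant. -/
def IsDefinableMap (s t : ImaginarySort L M) (A : Set s.Point) (B : Set t.Point)
    (f : s.Point → t.Point) : Prop :=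
  Set.MapsTo f A B ∧
    (Set.univ : Set M).Definable L
      {p : Fin s.arity ⊕ Fin t.arity → M |
        s.cls (p ∘ Sum.inl) ∈ A ∧ f (s.cls (p ∘ Sum.inl)) = t.cls (p ∘ Sum.inr)}

end ImaginarySort

/-- A rank on the nonempty interpretable sets of `M`, subject to the Borovik–Poizat axioms.
The value of `rk` on the empty set and on non-interpretable sets plays no role. -/
structure RankFunction (L : Language) (M : Type*) [L.Structure M] where
  /-- The rank of an interpretable set. -/
  rk : (s : ImaginarySort L M) → Set s.Point → ℕ
  /-- Monotonicity. -/
  succ_le_rk_iff : ∀ (s : ImaginarySort L M) (A : Set s.Point), s.IsDefinable A → A.Nonempty →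
    ∀ n : ℕ, n + 1 ≤ rk s A ↔
      ∃ F : ℕ → Set s.Point,
        (∀ k, s.IsDefinable (F k) ∧ (F k).Nonempty ∧ F k ⊆ A ∧ n ≤ rk s (F k)) ∧
        Pairwise fun k l => Disjoint (F k) (F l)
  /-- Definability of the rank. -/
  definable_rk : ∀ (s t : ImaginarySort L M) (A : Set s.Point) (B : Set t.Point)
    (f : s.Point → t.Point), s.IsDefinable A → t.IsDefinable B →
    ImaginarySort.IsDefinableMap s t A B f → ∀ n : ℕ,
      t.IsDefinable {b | b ∈ B ∧ (A ∩ f ⁻¹' {b}).Nonempty ∧ rk s (A ∩ f ⁻¹' {b}) = n}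
  /-- Additivity of the rank. -/
  additive_rk : ∀ (s t : ImaginarySort L M) (A : Set s.Point) (B : Set t.Point)
    (f : s.Point → t.Point), s.IsDefinable A → t.IsDefinable B →
    ImaginarySort.IsDefinableMap s t A B f → A.Nonempty → f '' A = B → ∀ n : ℕ,
      (∀ b ∈ B, rk s (A ∩ f ⁻¹' {b}) = n) → rk s A = rk t B + n
  /-- Elimination of infinite quantifiers. -/
  bounded_of_finite : ∀ (s t : ImaginarySort L M) (A : Set s.Point) (B : Set t.Point)
    (f : s.Point → t.Point), s.IsDefinable A → t.IsDefinable B →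
    ImaginarySort.IsDefinableMap s t A B f →
      ∃ m : ℕ, ∀ b ∈ B, (A ∩ f ⁻¹' {b}).Finite → (A ∩ f ⁻¹' {b}).ncard ≤ m

/-- A ranked group: a group carrying a first-order structure in which the multiplication is
definable and whose interpretable sets are ranked. -/
structure IsRankedGroup (L : Language) (G : Type*) [Group G] [L.Structure G] : Prop where
  definable_mul : (Set.univ : Set G).Definable L {p : Fin 3 → G | p 0 * p 1 = p 2}
  exists_rank : Nonempty (RankFunction L G)

/-- The subgroup `H` is definable (with parameters). -/
def IsDefinableSubgroup (L : Language) {G : Type*} [Group G] [L.Structure G]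
    (H : Subgroup G) : Prop :=
  (Set.univ : Set G).Definable₁ L (H : Set G)

/-- The subgroup `H` is connected: it has no proper definable subgroup of finite index. -/
def IsConnectedSubgroup (L : Language) {G : Type*} [Group G] [L.Structure G]
    (H : Subgroup G) : Prop :=
  ∀ K : Subgroup G, IsDefinableSubgroup L K → K ≤ H → K.relIndex H ≠ 0 → K = H

/-- The conjugate `C ^ g = g⁻¹ C g`. -/
def conjSubgroup {G : Type*} [Group G] (C : Subgroup G) (g : G) : Subgroup G :=
  C.map (MulAut.conj g⁻¹).toMonoidHom

/-- `C < G` is a quasi-Frobenius group: `C` is a proper subgroup, of finite index in its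
normalizer, and TI. -/
structure IsQuasiFrobenius {G : Type*} [Group G] (C : Subgroup G) : Prop where
  ne_top : C ≠ ⊤
  finite_index : C.relIndex (Subgroup.normalizer (C : Set G)) ≠ 0
  ti : ∀ g : G, g ∉ Subgroup.normalizer (C : Set G) → conjSubgroup C g ⊓ C = ⊥

/-! Some conjugate of an involution lies in `C`, so let `i` be an involution of `C`. As `C` is TI,
the centralizer of a nontrivial element of `C` lies in the normalizer `N` of `C`, and `C` has finite
index in `N`. So a subgroup meeting `C` trivially meets `N` in a finite group, and `i` has only
finitely many fixed points on it.

An involutive automorphism of a connected group with finitely many fixed points is inversion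
(`conj_eq_inv_of_finite`). Hence `i` inverts `A`; as `A` is normal, so does every conjugate of `i`.
A product of two of them therefore centralizes `A`: every `g⁻¹ * i * g * i` lies in `D`, the
centralizer of `A`. Moreover `D` meets `C` trivially, since `A` is infinite. The connected component
`B` of `D` is normal and is inverted by `i`, hence abelian.

The fibres of `g ↦ g⁻¹ * i * g * i` are cosets of the centralizer of `i`, which lies in `N`. So rk G
≤ rk D + rk N = rk B + rk C = rk BC, and `B * C` is all of `G` by connectedness. Thus `B` is the
required complement.

The group-theoretic tool behind the inversion lemma is that a connected group has Morley degree one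
(`inter_nonempty_of_isLarge`); it is proved through almost-stabilizers and a double count on pairs.
-/

section Definability

variable {L : Language} {M : Type*} [L.Structure M] {α β : Type*}

/-! ### Closure of definability under first-order operations and group operations. -/

namespace Set.Definable

theorem setOf_and {P Q : (α → M) → Prop} (hP : (univ : Set M).Definable L {v | P v})
    (hQ : (univ : Set M).Definable L {v | Q v}) :
    (univ : Set M).Definable L {v | P v ∧ Q v} := hP.inter hQ

theorem setOf_not {P : (α → M) → Prop} (hP : (univ : Set M).Definable L {v | P v}) :
    (univ : Set M).Definable L {v | ¬ P v} := hP.compl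

theorem setOf_imp {P Q : (α → M) → Prop} (hP : (univ : Set M).Definable L {v | P v})
    (hQ : (univ : Set M).Definable L {v | Q v}) :
    (univ : Set M).Definable L {v | P v → Q v} := hP.himp hQ

theorem setOf_exists {P : (α → M) → M → Prop}
    (h : (univ : Set M).Definable L
      {p : α ⊕ Fin 1 → M | P (fun a => p (Sum.inl a)) (p (Sum.inr 0))}) :
    (univ : Set M).Definable L {v | ∃ x, P v x} := by
  convert h.exists_of_finite using 1
  ext v
  simp only [mem_ofPred_eq, Sum.elim_inl, Sum.elim_inr]
  exact ⟨fun ⟨x, hx⟩ => ⟨fun _ => x, hx⟩, fun ⟨u, hu⟩ => ⟨u 0, hu⟩⟩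

theorem setOf_forall {P : (α → M) → M → Prop}
    (h : (univ : Set M).Definable L
      {p : α ⊕ Fin 1 → M | P (fun a => p (Sum.inl a)) (p (Sum.inr 0))}) :
    (univ : Set M).Definable L {v | ∀ x, P v x} := by
  convert h.forall_of_finite using 1
  ext v
  simp only [mem_ofPred_eq, Sum.elim_inl, Sum.elim_inr]
  exact ⟨fun hx u => hx _, fun hu x => hu (fun _ => x)⟩

theorem setOf_mem {X : Set M} (hX : (univ : Set M).Definable₁ L X) {f : (α → M) → M}
    (hf : (univ : Set M).DefinableFun L f) :
    (univ : Set M).Definable L {v | f v ∈ X} :=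
  Definable.preimage_map (F := fun v (_ : Fin 1) => f v) (fun _ => hf) hX

theorem setOf_eq {f g : (α → M) → M}
    (hf : (univ : Set M).DefinableFun L f) (hg : (univ : Set M).DefinableFun L g) :
    (univ : Set M).Definable L {v | f v = g v} := hf.ofPred_eq hg

end Set.Definable

theorem Set.DefinableFun.const (a : M) :
    (univ : Set M).DefinableFun L (fun _ : α → M => a) :=
  L.definableFun_const α (mem_univ a)

namespace IsRankedGroup

variable {G : Type*} [Group G] [L.Structure G]

theorem definableFun_mul (hG : IsRankedGroup L G) {f g : (α → G) → G}
    (hf : (Set.univ : Set G).DefinableFun L f) (hg : (Set.univ : Set G).DefinableFun L g) :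
    (Set.univ : Set G).DefinableFun L (fun v => f v * g v) := by
  have h : (Set.univ : Set G).DefinableFun L (fun v : Fin 2 → G => v 0 * v 1) :=
    hG.definable_mul.preimage_comp ![some 0, some 1, none]
  refine Set.DefinableFun.comp (g := fun v => ![f v, g v]) (fun i => ?_) h
  fin_cases i
  · exact hf
  · exact hg

theorem definableFun_inv (hG : IsRankedGroup L G) {f : (α → G) → G}
    (hf : (Set.univ : Set G).DefinableFun L f) :
    (Set.univ : Set G).DefinableFun L (fun v => (f v)⁻¹) := by
  have h : (Set.univ : Set G).DefinableFun L (fun v : Fin 1 → G => (v 0)⁻¹) := by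
    have : (Set.univ : Set G).Definable L {w : Option (Fin 1) → G | w (some 0) * w none = 1} :=
      Set.Definable.setOf_eq (hG.definableFun_mul (Set.DefinableFun.proj L) (Set.DefinableFun.proj L))
        (Set.DefinableFun.const 1)
    refine (congrArg (Set.univ.Definable L) ?_).mpr this
    ext w
    exact inv_eq_iff_mul_eq_one
  exact Set.DefinableFun.comp (g := fun v _ => f v) (fun i => hf) h

end IsRankedGroup

end Definability

/-! ### Definable sets and maps in imaginary sorts. -/

namespace ImaginarySort

variable {L : Language} {M : Type*} [L.Structure M] {s t : ImaginarySort L M}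

theorem IsDefinable.inter {A B : Set s.Point} (hA : s.IsDefinable A) (hB : s.IsDefinable B) :
    s.IsDefinable (A ∩ B) := Set.Definable.inter hA hB

theorem IsDefinable.union {A B : Set s.Point} (hA : s.IsDefinable A) (hB : s.IsDefinable B) :
    s.IsDefinable (A ∪ B) := Set.Definable.union hA hB

theorem IsDefinable.diff {A B : Set s.Point} (hA : s.IsDefinable A) (hB : s.IsDefinable B) :
    s.IsDefinable (A \ B) := Set.Definable.sdiff hA hB

theorem isDefinable_singleton (x : s.Point) : s.IsDefinable {x} := by
  obtain ⟨a, rfl⟩ := Quotient.exists_rep x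
  have := s.definable_rel.preimage_map (F := fun v => Sum.elim v a) fun i => by
    cases i with
    | inl i => exact Set.DefinableFun.proj L
    | inr i => exact Set.DefinableFun.const (a i)
  refine (congrArg (Set.univ.Definable L) ?_).mpr this
  ext v
  exact Quotient.eq

theorem IsDefinable.biUnion_finset {ι : Type*} {F : ι → Set s.Point}
    (hF : ∀ k, s.IsDefinable (F k)) (S : Finset ι) : s.IsDefinable (⋃ k ∈ S, F k) := by
  have := Set.definable_biUnion_finset (fun k => hF k) S
  simpa [IsDefinable, Set.preimage_iUnion] using this

theorem IsDefinableMap.isDefinable_image {A : Set s.Point} {B : Set t.Point}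
    {f : s.Point → t.Point} (hf : IsDefinableMap s t A B f) : t.IsDefinable (f '' A) := by
  have := Set.Definable.image_comp hf.2 (Sum.inr : Fin t.arity → _)
  refine (congrArg (Set.univ.Definable L) ?_).mpr this
  ext y
  constructor
  · rintro ⟨a, ha, hy⟩
    obtain ⟨x, rfl⟩ := Quotient.exists_rep a
    exact ⟨Sum.elim x y, ⟨ha, hy⟩, rfl⟩
  · rintro ⟨p, ⟨hp, hq⟩, rfl⟩
    exact ⟨_, hp, hq⟩

theorem IsDefinableMap.inter_preimage {A : Set s.Point} {B B' : Set t.Point}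
    {f : s.Point → t.Point} (hf : IsDefinableMap s t A B f) (hB' : t.IsDefinable B') :
    IsDefinableMap s t (A ∩ f ⁻¹' B') B' f := by
  refine ⟨fun x hx => hx.2, ?_⟩
  refine (congrArg (Set.univ.Definable L) ?_).mpr (hf.2.inter (hB'.preimage_comp Sum.inr))
  ext p
  constructor
  · rintro ⟨⟨h1, h2⟩, h3⟩
    exact ⟨⟨h1, h3⟩, by simpa [h3] using h2⟩
  · rintro ⟨⟨h1, h3⟩, h2⟩
    exact ⟨⟨h1, by simpa [h3] using h2⟩, h3⟩

theorem IsDefinableMap.isDefinable_inter_preimage {A : Set s.Point} {B B' : Set t.Point}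
    {f : s.Point → t.Point} (hf : IsDefinableMap s t A B f) (hB' : t.IsDefinable B') :
    s.IsDefinable (A ∩ f ⁻¹' B') := by
  have := Set.Definable.image_comp (hf.inter_preimage hB').2 (Sum.inl : Fin s.arity → _)
  refine (congrArg (Set.univ.Definable L) ?_).mpr this
  ext x
  constructor
  · intro hx
    obtain ⟨y, hy⟩ := Quotient.exists_rep (f (s.cls x))
    exact ⟨Sum.elim x y, ⟨hx, hy.symm⟩, rfl⟩
  · rintro ⟨p, ⟨hp, hq⟩, rfl⟩
    exact hp

end ImaginarySort

/-! ### Rank calculus on imaginary sorts. -/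

namespace RankFunction

variable {L : Language} {M : Type*} [L.Structure M] (R : RankFunction L M)
  {s t : ImaginarySort L M}

/-- `A` is nonempty and has rank at least `n`. -/
def RankGE (s : ImaginarySort L M) (n : ℕ) (A : Set s.Point) : Prop :=
  A.Nonempty ∧ n ≤ R.rk s A

theorem rankGE_zero {A : Set s.Point} : R.RankGE s 0 A ↔ A.Nonempty := by simp [RankGE]

/-- The rank of the empty set is arbitrary. With nonemptiness built into `RankGE`, the monotonicity
axiom becomes a recursion on `n` without side conditions, on which the inductions below run. -/
theorem rankGE_succ {A : Set s.Point} (hA : s.IsDefinable A) {n : ℕ} :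
    R.RankGE s (n + 1) A ↔ ∃ F : ℕ → Set s.Point,
      (∀ k, s.IsDefinable (F k) ∧ R.RankGE s n (F k) ∧ F k ⊆ A) ∧
        Pairwise fun k l => Disjoint (F k) (F l) := by
  constructor
  · rintro ⟨hne, h⟩
    obtain ⟨F, hF, hd⟩ := (R.succ_le_rk_iff s A hA hne n).1 h
    exact ⟨F, fun k => ⟨(hF k).1, ⟨(hF k).2.1, (hF k).2.2.2⟩, (hF k).2.2.1⟩, hd⟩
  · rintro ⟨F, hF, hd⟩
    have hne : A.Nonempty := (hF 0).2.1.1.mono (hF 0).2.2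
    exact ⟨hne, (R.succ_le_rk_iff s A hA hne n).2
      ⟨F, fun k => ⟨(hF k).1, (hF k).2.1.1, (hF k).2.2, (hF k).2.1.2⟩, hd⟩⟩

variable {R}

theorem RankGE.mono {A B : Set s.Point} {n : ℕ} (h : R.RankGE s n A) (hA : s.IsDefinable A)
    (hB : s.IsDefinable B) (hAB : A ⊆ B) : R.RankGE s n B := by
  cases n with
  | zero => exact R.rankGE_zero.2 (h.1.mono hAB)
  | succ n =>
    obtain ⟨F, hF, hd⟩ := (R.rankGE_succ hA).1 h
    exact (R.rankGE_succ hB).2 ⟨F, fun k => ⟨(hF k).1, (hF k).2.1, (hF k).2.2.trans hAB⟩, hd⟩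

/-- By induction each of the infinitely many disjoint pieces of rank at least `n` meets `A` or `B`
in rank at least `n`; one of the two happens infinitely often. -/
theorem RankGE.or_of_union {n : ℕ} : ∀ {A B : Set s.Point}, R.RankGE s n (A ∪ B) →
    s.IsDefinable A → s.IsDefinable B → R.RankGE s n A ∨ R.RankGE s n B := by
  induction n with
  | zero =>
    intro A B h _ _
    simpa [rankGE_zero, Set.union_nonempty] using h
  | succ n ih =>
    intro A B h hA hB
    obtain ⟨F, hF, hd⟩ := (R.rankGE_succ (hA.union hB)).1 h
    have key (C D : Set s.Point) (hC : s.IsDefinable C)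
        (h : {k | R.RankGE s n (F k ∩ C)}.Infinite) : R.RankGE s (n + 1) C := by
      let e := h.natEmbedding
      refine (R.rankGE_succ hC).2 ⟨fun k => F (e k) ∩ C, fun k =>
        ⟨(hF _).1.inter hC, (e k).2, Set.inter_subset_right⟩, fun k l hkl => ?_⟩
      exact (hd (fun h => hkl (e.injective (Subtype.ext h)))).mono
        Set.inter_subset_left Set.inter_subset_left
    have hU : {k | R.RankGE s n (F k ∩ A)} ∪ {k | R.RankGE s n (F k ∩ B)} = Set.univ := by
      refine Set.eq_univ_of_forall fun k => ?_
      refine ih ?_ ((hF k).1.inter hA) ((hF k).1.inter hB)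
      rw [← Set.inter_union_distrib_left, Set.inter_eq_left.2 (hF k).2.2]
      exact (hF k).2.1
    rcases Set.infinite_union.1 (hU ▸ Set.infinite_univ) with h | h
    · exact Or.inl (key A B hA h)
    · exact Or.inr (key B A hB h)

theorem RankGE.exists_of_biUnion {ι : Type*} {S : Finset ι} {n : ℕ} {F : ι → Set s.Point}
    (hF : ∀ k, s.IsDefinable (F k)) (h : R.RankGE s n (⋃ k ∈ S, F k)) :
    ∃ k ∈ S, R.RankGE s n (F k) := by
  classical
  induction S using Finset.induction with
  | empty => simpa using h.1
  | insert a S _ ih =>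
    rw [Finset.set_biUnion_insert] at h
    rcases h.or_of_union (hF a) (.biUnion_finset hF S) with h | h
    · exact ⟨a, Finset.mem_insert_self a S, h⟩
    · obtain ⟨k, hk, h⟩ := ih h
      exact ⟨k, Finset.mem_insert_of_mem hk, h⟩

theorem rk_eq_zero_of_finite {A : Set s.Point} (hA : s.IsDefinable A) (hne : A.Nonempty)
    (h : A.Finite) : R.rk s A = 0 := by
  by_contra h0
  obtain ⟨F, hF, hd⟩ := (R.rankGE_succ hA).1 ⟨hne, Nat.one_le_iff_ne_zero.2 h0⟩
  choose x hx using fun k => (hF k).2.1.1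
  refine h.not_infinite (Set.infinite_of_injective_forall_mem (f := x) (fun k l hkl => ?_)
    fun k => (hF k).2.2 (hx k))
  by_contra hne
  exact Set.disjoint_left.1 (hd hne) (hx k) (hkl ▸ hx l)

theorem rk_eq_add_of_fibres {A : Set s.Point} {B : Set t.Point} {f : s.Point → t.Point}
    (hA : s.IsDefinable A) (hf : ImaginarySort.IsDefinableMap s t A B f) (hne : A.Nonempty) {n : ℕ}
    (h : ∀ a ∈ A, R.rk s (A ∩ f ⁻¹' {f a}) = n) : R.rk s A = R.rk t (f '' A) + n := by
  refine R.additive_rk s t A (f '' A) f hA hf.isDefinable_image ⟨Set.mapsTo_image f A, hf.2⟩ hne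
    rfl n ?_
  rintro _ ⟨a, ha, rfl⟩
  exact h a ha

theorem rankGE_image_of_finite_fibres {A : Set s.Point} {B : Set t.Point} {f : s.Point → t.Point}
    (hA : s.IsDefinable A) (hf : ImaginarySort.IsDefinableMap s t A B f)
    (hfin : ∀ a ∈ A, (A ∩ f ⁻¹' {f a}).Finite) {n : ℕ} :
    R.RankGE t n (f '' A) ↔ R.RankGE s n A := by
  refine ⟨fun h => ?_, fun h => ?_⟩
  all_goals
    have hne : A.Nonempty := by first | exact h.1 | exact Set.image_nonempty.1 h.1
    have := rk_eq_add_of_fibres (R := R) (n := 0) hA hf hne fun a ha => rk_eq_zero_of_finite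
      (hf.isDefinable_inter_preimage (ImaginarySort.isDefinable_singleton _)) ⟨a, ha, rfl⟩
      (hfin a ha)
  · exact ⟨hne, h.2.trans this.ge⟩
  · exact ⟨hne.image f, h.2.trans this.le⟩

/-- Fibre ranks are below `k`, so `Z` splits into finitely many definable parts on which the fibre
rank is constant. Additivity bounds the rank of each part. -/
theorem not_rankGE_of_fibres {Z : Set s.Point} {B : Set t.Point} {f : s.Point → t.Point}
    (hZ : s.IsDefinable Z) (hB : t.IsDefinable B) (hf : ImaginarySort.IsDefinableMap s t Z B f)
    {n k : ℕ} (hn : R.rk t B ≤ n) (hk : ∀ b ∈ B, ¬ R.RankGE s k (Z ∩ f ⁻¹' {b})) :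
    ¬ R.RankGE s (n + k) Z := by
  intro h
  let B' (j : ℕ) : Set t.Point :=
    {b | b ∈ B ∧ (Z ∩ f ⁻¹' {b}).Nonempty ∧ R.rk s (Z ∩ f ⁻¹' {b}) = j}
  have hB' (j) : t.IsDefinable (B' j) := R.definable_rk s t Z B f hZ hB hf j
  have hZ' (j) : s.IsDefinable (Z ∩ f ⁻¹' B' j) := hf.isDefinable_inter_preimage (hB' j)
  have hU : Z = ⋃ j ∈ Finset.range k, Z ∩ f ⁻¹' B' j := by
    refine Set.Subset.antisymm (fun z hz => ?_) (by simp)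
    have hne : (Z ∩ f ⁻¹' {f z}).Nonempty := ⟨z, hz, rfl⟩
    have hlt : R.rk s (Z ∩ f ⁻¹' {f z}) < k := by
      by_contra hge
      exact hk _ (hf.1 hz) ⟨hne, not_lt.1 hge⟩
    exact Set.mem_biUnion (Finset.mem_range.2 hlt) ⟨hz, hf.1 hz, hne, rfl⟩
  rw [hU] at h
  obtain ⟨j, hj, h⟩ := h.exists_of_biUnion hZ'
  rw [Finset.mem_range] at hj
  have hrk := rk_eq_add_of_fibres (R := R) (n := j) (hZ' j) (hf.inter_preimage (hB' j)) h.1 (by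
    rintro a ⟨ha, haB⟩
    refine Eq.trans ?_ haB.2.2
    congr 1
    ext x
    constructor
    · exact fun hx => ⟨hx.1.1, hx.2⟩
    · rintro ⟨hx, hxa⟩
      exact ⟨⟨hx, by rwa [Set.mem_preimage, show f x = f a from hxa]⟩, hxa⟩)
  have himg : R.RankGE t (R.rk t (f '' (Z ∩ f ⁻¹' B' j))) (f '' (Z ∩ f ⁻¹' B' j)) :=
    ⟨h.1.image f, le_rfl⟩
  have := (himg.mono (hf.inter_preimage (hB' j)).isDefinable_image hB
    (by rintro _ ⟨a, ha, rfl⟩; exact ha.2.1)).2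
  have := h.2
  omega

theorem not_rankGE_succ_of_le {A B : Set s.Point} (hA : s.IsDefinable A) (hB : s.IsDefinable B)
    (hAB : A ⊆ B) : ¬ R.RankGE s (R.rk s B + 1) A := fun h => by
  have := (h.mono hA hB hAB).2
  omega

/-- A definable set of full rank contains a definable subset of full rank that is not the union
of two disjoint definable subsets of full rank. -/
theorem RankGE.exists_irreducible {n : ℕ} {A : Set s.Point} (hA : s.IsDefinable A)
    (h : R.RankGE s n A) (h' : ¬ R.RankGE s (n + 1) A) :
    ∃ X ⊆ A, s.IsDefinable X ∧ R.RankGE s n X ∧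
      ∀ Y ⊆ X, s.IsDefinable Y → R.RankGE s n Y → ¬ R.RankGE s n (X \ Y) := by
  by_contra! hcon
  -- Otherwise splitting can be iterated forever. The successive differences of the resulting
  -- descending chain are infinitely many disjoint sets of rank at least `n`, against `h'`.
  let T := {X : Set s.Point // X ⊆ A ∧ s.IsDefinable X ∧ R.RankGE s n X}
  have step (X : T) : ∃ Y : T, Y.1 ⊆ X.1 ∧ R.RankGE s n (X.1 \ Y.1) := by
    obtain ⟨Y, hYX, hY, hY', hd⟩ := hcon X.1 X.2.1 X.2.2.1 X.2.2.2
    exact ⟨⟨Y, hYX.trans X.2.1, hY, hY'⟩, hYX, hd⟩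
  choose g hg hg' using step
  let F (k : ℕ) : T := g^[k] ⟨A, subset_rfl, hA, h⟩
  have hFs (k) : F (k + 1) = g (F k) := Function.iterate_succ_apply' _ _ _
  have hanti : Antitone fun k => (F k).1 := antitone_nat_of_succ_le fun k => by
    rw [hFs]; exact hg _
  refine h' ((R.rankGE_succ hA).2 ⟨fun k => (F k).1 \ (F (k + 1)).1, fun k =>
    ⟨(F k).2.2.1.diff (F (k + 1)).2.2.1, ?_, Set.sdiff_subset.trans (F k).2.1⟩, ?_⟩)
  · show R.RankGE s n ((F k).1 \ (F (k + 1)).1)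
    rw [hFs]; exact hg' _
  · refine (pairwise_disjoint_on _).2 fun k l hkl => ?_
    exact Set.disjoint_left.2 fun x hx hx' => hx.2 (hanti (Nat.succ_le_of_lt hkl) hx'.1)

end RankFunction

/-! ### Rank of definable subsets of `M` and of `M × M`. -/

section HomeSort

variable {L : Language} {M : Type*} [L.Structure M]

variable (L M) in
/-- The cartesian power `M ^ n` as a sort of imaginaries. -/
def homeSort (n : ℕ) : ImaginarySort L M where
  arity := n
  rel := ⊥
  definable_rel := by
    have := Set.definable_iInter_of_finite fun i : Fin n =>
      Set.Definable.setOf_eq (L := L) (M := M) (Set.DefinableFun.proj L (i := Sum.inl i))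
        (Set.DefinableFun.proj L (i := Sum.inr i))
    refine (congrArg (Set.univ.Definable L) ?_).mpr this
    ext p
    simp only [Set.mem_iInter]
    exact funext_iff

namespace homeSort

/-- The tuple of coordinates of a point of `M ^ n`. -/
def val {n : ℕ} (q : (homeSort L M n).Point) : Fin n → M := Quotient.lift id (fun _ _ h => h) q

theorem cls_val {n : ℕ} (q : (homeSort L M n).Point) : (homeSort L M n).cls (val q) = q := by
  obtain ⟨a, rfl⟩ := Quotient.exists_rep q
  rfl

theorem val_injective {n : ℕ} : Function.Injective (val : (homeSort L M n).Point → _) :=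
  Function.LeftInverse.injective cls_val

/-- The element of `M` given by a point of `M ^ 1`. -/
def elt (q : (homeSort L M 1).Point) : M := val q 0

variable (L) in
/-- An element of `M` as a point of `M ^ 1`. -/
def pt (x : M) : (homeSort L M 1).Point := (homeSort L M 1).cls fun _ => x

@[simp] theorem elt_pt (x : M) : elt (pt L x) = x := rfl

theorem pt_elt (q : (homeSort L M 1).Point) : pt L (elt q) = q := by
  refine val_injective (funext fun i => ?_)
  rw [Subsingleton.elim i 0]
  rfl

theorem pt_injective : Function.Injective (pt L : M → _) :=
  Function.LeftInverse.injective elt_pt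

/-- The pair of elements of `M` given by a point of `M ^ 2`. -/
def pair (q : (homeSort L M 2).Point) : M × M := (val q 0, val q 1)

variable (L) in
/-- A pair of elements of `M` as a point of `M ^ 2`. -/
def ptPair (x y : M) : (homeSort L M 2).Point := (homeSort L M 2).cls ![x, y]

@[simp] theorem pair_ptPair (x y : M) : pair (ptPair L x y) = (x, y) := rfl

/-- The `i`-th coordinate of a point of `M ^ 2`, as a point of `M ^ 1`. -/
def coord (i : Fin 2) (q : (homeSort L M 2).Point) : (homeSort L M 1).Point := pt L (val q i)

theorem isDefinable_elt {X : Set M} (hX : (Set.univ : Set M).Definable₁ L X) :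
    (homeSort L M 1).IsDefinable (elt ⁻¹' X) := hX

theorem isDefinable_pair {Z : Set (M × M)} (hZ : (Set.univ : Set M).Definable₂ L Z) :
    (homeSort L M 2).IsDefinable (pair ⁻¹' Z) := hZ

theorem isDefinableMap_of_graph {X Y : Set M} {φ : M → M} (hXY : Set.MapsTo φ X Y)
    (hφ : (Set.univ : Set M).Definable₂ L {p | p.1 ∈ X ∧ φ p.1 = p.2}) :
    ImaginarySort.IsDefinableMap (homeSort L M 1) (homeSort L M 1) (elt ⁻¹' X) (elt ⁻¹' Y)
      (fun q => pt L (φ (elt q))) := by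
  refine ⟨fun q hq => hXY hq, ?_⟩
  refine (congrArg (Set.univ.Definable L) ?_).mpr
    (hφ.preimage_comp ![Sum.inl (0 : Fin 1), Sum.inr (0 : Fin 1)])
  ext p
  refine and_congr Iff.rfl ⟨fun h => congrArg elt h, fun h => ?_⟩
  exact (congrArg (pt L) h).trans (pt_elt ((homeSort L M 1).cls (p ∘ Sum.inr)))

theorem isDefinableMap_coord (i : Fin 2) {Z : Set (M × M)} {B : Set M}
    (hZB : ∀ p ∈ Z, ![p.1, p.2] i ∈ B) (hZ : (Set.univ : Set M).Definable₂ L Z) :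
    ImaginarySort.IsDefinableMap (homeSort L M 2) (homeSort L M 1) (pair ⁻¹' Z) (elt ⁻¹' B)
      (coord i) := by
  refine ⟨fun q hq => ?_, ?_⟩
  · have := hZB _ hq
    fin_cases i <;> exact this
  · have h1 := hZ.preimage_comp (Sum.inl : Fin 2 → Fin 2 ⊕ Fin 1)
    have h2 := Set.Definable.setOf_eq (Set.DefinableFun.proj L (M := M) (i := Sum.inl i))
      (Set.DefinableFun.proj L (i := Sum.inr (0 : Fin 1)))
    refine (congrArg (Set.univ.Definable L) ?_).mpr (h1.inter h2)
    ext p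
    refine and_congr Iff.rfl ⟨fun h => congrArg elt h, fun h => ?_⟩
    exact (congrArg (pt L) h).trans (pt_elt ((homeSort L M 1).cls (p ∘ Sum.inr)))

end homeSort

namespace RankFunction

open homeSort

variable (R : RankFunction L M)

/-- The rank of a definable subset of `M`. -/
def rank (X : Set M) : ℕ := R.rk (homeSort L M 1) (elt ⁻¹' X)

/-- The subset `X` of `M` is nonempty and has rank at least `n`. -/
def IsLarge (n : ℕ) (X : Set M) : Prop := R.RankGE (homeSort L M 1) n (elt ⁻¹' X)

variable {R} {X Y : Set M} {n m : ℕ}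

theorem IsLarge.nonempty (h : R.IsLarge n X) : X.Nonempty := h.1.imp' elt fun _ h => h

theorem preimage_elt_nonempty (h : X.Nonempty) :
    (elt ⁻¹' X : Set (homeSort L M 1).Point).Nonempty :=
  h.imp' (pt L) fun _ h => h

theorem isLarge_iff : R.IsLarge n X ↔ X.Nonempty ∧ n ≤ R.rank X :=
  ⟨fun h => ⟨h.nonempty, h.2⟩, fun h => ⟨preimage_elt_nonempty h.1, h.2⟩⟩

theorem isLarge_rank (h : X.Nonempty) : R.IsLarge (R.rank X) X :=
  isLarge_iff.2 ⟨h, le_rfl⟩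

theorem isLarge_succ (hX : (Set.univ : Set M).Definable₁ L X) {F : ℕ → Set M}
    (hF : ∀ k, (Set.univ : Set M).Definable₁ L (F k)) (hF' : ∀ k, R.IsLarge n (F k))
    (hFX : ∀ k, F k ⊆ X) (hd : Pairwise fun k l => Disjoint (F k) (F l)) :
    R.IsLarge (n + 1) X :=
  (R.rankGE_succ (isDefinable_elt hX)).2 ⟨fun k => elt ⁻¹' F k,
    fun k => ⟨hF k, hF' k, Set.preimage_mono (hFX k)⟩,
    fun _ _ hkl => (hd hkl).preimage _⟩

theorem IsLarge.mono (h : R.IsLarge n X) (hX : (Set.univ : Set M).Definable₁ L X)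
    (hY : (Set.univ : Set M).Definable₁ L Y) (hXY : X ⊆ Y) : R.IsLarge n Y :=
  RankGE.mono h hX hY (Set.preimage_mono hXY)

theorem IsLarge.or_of_union (h : R.IsLarge n (X ∪ Y)) (hX : (Set.univ : Set M).Definable₁ L X)
    (hY : (Set.univ : Set M).Definable₁ L Y) : R.IsLarge n X ∨ R.IsLarge n Y :=
  RankGE.or_of_union h hX hY

theorem IsLarge.exists_of_biUnion {ι : Type*} {S : Finset ι} {F : ι → Set M}
    (hF : ∀ k, (Set.univ : Set M).Definable₁ L (F k)) (h : R.IsLarge n (⋃ k ∈ S, F k)) :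
    ∃ k ∈ S, R.IsLarge n (F k) := by
  refine RankGE.exists_of_biUnion (F := fun k => elt ⁻¹' F k) hF ?_
  simpa [IsLarge, Set.preimage_iUnion] using h

theorem definable_biUnion {ι : Type*} {F : ι → Set M}
    (hF : ∀ k, (Set.univ : Set M).Definable₁ L (F k)) (S : Finset ι) :
    (Set.univ : Set M).Definable₁ L (⋃ k ∈ S, F k) := by
  have := ImaginarySort.IsDefinable.biUnion_finset (fun k => isDefinable_elt (hF k)) S
  rwa [← Set.preimage_iUnion₂] at this

theorem not_isLarge_rank_succ (hX : (Set.univ : Set M).Definable₁ L X)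
    (hY : (Set.univ : Set M).Definable₁ L Y) (hXY : X ⊆ Y) : ¬ R.IsLarge (R.rank Y + 1) X :=
  not_rankGE_succ_of_le hX hY (Set.preimage_mono hXY)

theorem rank_mono (hX : (Set.univ : Set M).Definable₁ L X)
    (hY : (Set.univ : Set M).Definable₁ L Y) (hne : X.Nonempty) (hXY : X ⊆ Y) :
    R.rank X ≤ R.rank Y :=
  ((isLarge_rank hne).mono hX hY hXY).2

theorem IsLarge.exists_irreducible (hX : (Set.univ : Set M).Definable₁ L X)
    (h : R.IsLarge n X) (h' : ¬ R.IsLarge (n + 1) X) :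
    ∃ Y ⊆ X, (Set.univ : Set M).Definable₁ L Y ∧ R.IsLarge n Y ∧
      ∀ Z ⊆ Y, (Set.univ : Set M).Definable₁ L Z → R.IsLarge n Z → ¬ R.IsLarge n (Y \ Z) := by
  obtain ⟨Y, hYX, hY, hYn, hirr⟩ :=
    RankGE.exists_irreducible (isDefinable_elt hX) h h'
  have he : elt ⁻¹' (pt L ⁻¹' Y) = Y := by
    ext q
    simp [pt_elt]
  refine ⟨pt L ⁻¹' Y, fun x hx => hYX hx, ?_, ?_, fun Z hZY hZ hZn hd => ?_⟩
  · change (homeSort L M 1).IsDefinable (elt ⁻¹' (pt L ⁻¹' Y))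
    rwa [he]
  · rwa [IsLarge, he]
  · refine hirr (elt ⁻¹' Z) (he ▸ Set.preimage_mono hZY) hZ hZn ?_
    rwa [IsLarge, Set.preimage_sdiff, he] at hd

theorem preimage_elt_image (φ : M → M) (X : Set M) :
    (elt ⁻¹' (φ '' X) : Set (homeSort L M 1).Point) =
      (fun q : (homeSort L M 1).Point => pt L (φ (elt q))) '' (elt ⁻¹' X) := by
  ext q
  constructor
  · rintro ⟨x, hx, h⟩
    exact ⟨pt L x, hx, by simp [h, pt_elt]⟩
  · rintro ⟨q, hq, rfl⟩
    exact ⟨elt q, hq, rfl⟩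

theorem isLarge_image {φ : M → M} (hX : (Set.univ : Set M).Definable₁ L X)
    (hφ : (Set.univ : Set M).Definable₂ L {p | p.1 ∈ X ∧ φ p.1 = p.2})
    (hfin : ∀ x ∈ X, (X ∩ φ ⁻¹' {φ x}).Finite) : R.IsLarge n (φ '' X) ↔ R.IsLarge n X := by
  rw [IsLarge, preimage_elt_image]
  refine rankGE_image_of_finite_fibres (isDefinable_elt hX)
    (isDefinableMap_of_graph (Set.mapsTo_image φ X) hφ)
    fun q hq => ?_
  refine ((hfin (elt q) hq).image (pt L)).subset fun r hr => ⟨elt r, ⟨hr.1, ?_⟩, pt_elt r⟩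
  exact pt_injective hr.2

theorem rank_eq_add_of_fibres {φ : M → M} (hX : (Set.univ : Set M).Definable₁ L X)
    (hφ : (Set.univ : Set M).Definable₂ L {p | p.1 ∈ X ∧ φ p.1 = p.2}) (hne : X.Nonempty)
    (h : ∀ x ∈ X, R.rank (X ∩ φ ⁻¹' {φ x}) = n) : R.rank X = R.rank (φ '' X) + n := by
  rw [rank, rank, preimage_elt_image]
  refine rk_eq_add_of_fibres (isDefinable_elt hX)
    (isDefinableMap_of_graph (Set.mapsTo_image φ X) hφ)
    (preimage_elt_nonempty hne) fun q hq => (congrArg _ ?_).trans (h (elt q) hq)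
  ext r
  exact and_congr Iff.rfl pt_injective.eq_iff

theorem definable_image {φ : M → M} 
    (hφ : (Set.univ : Set M).Definable₂ L {p | p.1 ∈ X ∧ φ p.1 = p.2}) :
    (Set.univ : Set M).Definable₁ L (φ '' X) := by
  have := (isDefinableMap_of_graph (Set.mapsTo_image φ X) hφ).isDefinable_image
  rwa [← preimage_elt_image] at this

theorem isLarge_preimage_equiv {e : M ≃ M} (hX : (Set.univ : Set M).Definable₁ L X)
    (he : (Set.univ : Set M).DefinableFun L fun v : Fin 1 → M => e (v 0)) :
    R.IsLarge n (e ⁻¹' X) ↔ R.IsLarge n X := by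
  have he' : (Set.univ : Set M).DefinableFun L fun v : Fin 2 → M => e (v 0) :=
    Set.DefinableFun.comp (g := fun v (_ : Fin 1) => v 0) (fun _ => Set.DefinableFun.proj L) he
  have h := isLarge_image (R := R) (n := n) (X := e ⁻¹' X) (φ := e)
    (Set.Definable.setOf_mem hX he) ((Set.Definable.setOf_mem hX he').setOf_and
      (Set.Definable.setOf_eq he' (Set.DefinableFun.proj L)))
    (fun x _ => (Set.finite_singleton x).subset fun y hy => e.injective hy.2)
  rw [← h, Set.image_preimage_eq X e.surjective]

/-- The fibre over `g` of the `i`-th coordinate map on `Z`, projected to the `j`-th coordinate. -/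
def pairFibre (i j : Fin 2) (Z : Set (M × M)) (g : M) : Set M :=
  {x | ∃ p ∈ Z, ![p.1, p.2] i = g ∧ ![p.1, p.2] j = x}

/-- On a fibre of one coordinate the other coordinate is injective, so it preserves rank. Indices
`i` and `j` are kept general because both projections are needed. -/
theorem rankGE_fibre_coord {i j : Fin 2} (hij : i ≠ j) {Z : Set (M × M)}
    (hZ : (Set.univ : Set M).Definable₂ L Z) (b : (homeSort L M 1).Point) :
    R.RankGE (homeSort L M 2) n (pair ⁻¹' Z ∩ coord i ⁻¹' {b}) ↔
      R.IsLarge n (pairFibre i j Z (elt b)) := by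
  have hval (q : (homeSort L M 2).Point) (k : Fin 2) : ![(pair q).1, (pair q).2] k = val q k := by
    fin_cases k <;> rfl
  have hZ' : (Set.univ : Set M).Definable₂ L {p | p ∈ Z ∧ ![p.1, p.2] i = elt b} := by
    refine Set.Definable.setOf_and hZ (Set.Definable.setOf_eq ?_ (Set.DefinableFun.const _))
    fin_cases i <;> exact Set.DefinableFun.proj L
  have h1 : pair ⁻¹' {p | p ∈ Z ∧ ![p.1, p.2] i = elt b} = pair ⁻¹' Z ∩ coord i ⁻¹' {b} := by
    ext q
    refine and_congr Iff.rfl ?_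
    rw [hval]
    exact ⟨fun h => (congrArg (pt L) h).trans (pt_elt b), fun h => congrArg elt h⟩
  have h2 : coord j '' (pair ⁻¹' {p | p ∈ Z ∧ ![p.1, p.2] i = elt b}) =
      (elt ⁻¹' pairFibre i j Z (elt b) : Set (homeSort L M 1).Point) := by
    ext r
    constructor
    · rintro ⟨q, hq, rfl⟩
      exact ⟨pair q, hq.1, hq.2, hval q j⟩
    · rintro ⟨p, hp, hpi, hpj⟩
      refine ⟨ptPair L p.1 p.2, ⟨hp, hpi⟩, ?_⟩
      exact (congrArg (pt L) hpj).trans (pt_elt r)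
  have h3 := rankGE_image_of_finite_fibres (R := R) (s := homeSort L M 2) (t := homeSort L M 1)
    (n := n) (f := coord j) (isDefinable_pair hZ')
    (isDefinableMap_coord j (B := Set.univ) (fun _ _ => trivial) hZ')
    (fun q hq => (Set.finite_singleton q).subset fun r hr => by
      refine val_injective (funext fun k => ?_)
      have hqi : val q i = elt b := (hval q i).symm.trans hq.2
      have hri : val r i = elt b := (hval r i).symm.trans hr.1.2
      have hj : val r j = val q j := pt_injective hr.2
      have : k = i ∨ k = j := by omega
      rcases this with rfl | rfl
      · rw [hqi, hri]
      · exact hj)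
  rw [← h1, ← h3, h2, IsLarge]

/-- The axiom gives definability of "rank exactly `k`"; removing the values `k < n` from the
projection of `Z` leaves "rank at least `n`". This makes almost-stabilizers definable. -/
theorem definable_isLarge_fibre {Z : Set (M × M)} (hZ : (Set.univ : Set M).Definable₂ L Z)
    (R : RankFunction L M) (n : ℕ) :
    (Set.univ : Set M).Definable₁ L {g | R.IsLarge n {x | (g, x) ∈ Z}} := by
  have hmap := isDefinableMap_coord 0 (B := Set.univ) (fun _ _ => trivial) hZ
  have hd (k : ℕ) := R.definable_rk _ _ _ _ _ (isDefinable_pair hZ)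
    (isDefinable_elt (X := Set.univ) Set.definable_univ) hmap k
  have hne : (homeSort L M 1).IsDefinable (coord 0 '' (pair ⁻¹' Z)) := hmap.isDefinable_image
  have := hne.diff (.biUnion_finset hd (Finset.range n))
  change (homeSort L M 1).IsDefinable (elt ⁻¹' {g | R.IsLarge n {x | (g, x) ∈ Z}})
  refine (congrArg ((homeSort L M 1).IsDefinable) ?_).mpr this
  ext b
  have h0 := rankGE_fibre_coord (R := R) (n := n) (i := 0) (j := 1) (by simp) hZ b
  have hset : pairFibre 0 1 Z (elt b) = {x | (elt b, x) ∈ Z} := by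
    ext x
    constructor
    · rintro ⟨⟨p, q⟩, h, hp, hq⟩
      exact (show p = elt b from hp) ▸ (show q = x from hq) ▸ h
    · exact fun h => ⟨_, h, rfl, rfl⟩
  rw [hset] at h0
  refine h0.symm.trans ?_
  have himg : b ∈ coord 0 '' (pair ⁻¹' Z) ↔ (pair ⁻¹' Z ∩ coord 0 ⁻¹' {b}).Nonempty :=
    ⟨fun ⟨q, hq, h⟩ => ⟨q, hq, h⟩, fun ⟨q, hq, h⟩ => ⟨q, hq, h⟩⟩
  rw [Set.mem_sdiff, himg]
  refine and_congr_right fun hn => ?_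
  simp only [Set.mem_iUnion, Finset.mem_range, not_exists]
  constructor
  · rintro h k hk ⟨-, -, h'⟩
    omega
  · intro h
    by_contra hlt
    exact h _ (not_le.1 hlt) ⟨trivial, hn, rfl⟩

theorem not_rankGE_of_pairFibre {i j : Fin 2} (hij : i ≠ j) {Z : Set (M × M)}
    (hZ : (Set.univ : Set M).Definable₂ L Z) {B : Set M} (hB : (Set.univ : Set M).Definable₁ L B)
    (hZB : ∀ p ∈ Z, ![p.1, p.2] i ∈ B) (hn : R.rank B ≤ n)
    (h : ∀ b ∈ B, ¬ R.IsLarge m (pairFibre i j Z b)) :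
    ¬ R.RankGE (homeSort L M 2) (n + m) (pair ⁻¹' Z) :=
  not_rankGE_of_fibres (isDefinable_pair hZ) (isDefinable_elt hB) (isDefinableMap_coord i hZB hZ) hn fun b hb h' =>
    h _ hb ((rankGE_fibre_coord hij hZ b).1 h')

theorem definable_prod (hX : (Set.univ : Set M).Definable₁ L X)
    (hY : (Set.univ : Set M).Definable₁ L Y) : (Set.univ : Set M).Definable₂ L (X ×ˢ Y) :=
  (Set.Definable.setOf_mem hX (Set.DefinableFun.proj L)).setOf_and
    (Set.Definable.setOf_mem hY (Set.DefinableFun.proj L))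

/-- Every fibre of the first projection is a copy of `Y`, so additivity applies. -/
theorem rankGE_prod (hX : R.IsLarge n X) (hY : R.IsLarge m Y)
    (hXd : (Set.univ : Set M).Definable₁ L X) (hYd : (Set.univ : Set M).Definable₁ L Y) :
    R.RankGE (homeSort L M 2) (n + m) (pair ⁻¹' (X ×ˢ Y)) := by
  obtain ⟨y, hy⟩ := hY.nonempty
  obtain ⟨x, hx⟩ := hX.nonempty
  have hZ := definable_prod hXd hYd
  have hne : (pair ⁻¹' (X ×ˢ Y) : Set (homeSort L M 2).Point).Nonempty :=
    ⟨ptPair L x y, hx, hy⟩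
  have himg : coord 0 '' (pair ⁻¹' (X ×ˢ Y)) = (elt ⁻¹' X : Set (homeSort L M 1).Point) := by
    ext q
    constructor
    · rintro ⟨r, hr, rfl⟩
      exact hr.1
    · exact fun hq => ⟨ptPair L (elt q) y, ⟨hq, hy⟩, pt_elt q⟩
  have h := rk_eq_add_of_fibres (R := R) (n := R.rank Y) (s := homeSort L M 2)
    (t := homeSort L M 1) (f := coord 0) (isDefinable_pair hZ)
    (isDefinableMap_coord 0 (B := X) (fun p hp => hp.1) hZ) hne (by
      intro q hq
      have hset : pairFibre 0 1 (X ×ˢ Y) (elt (coord 0 q)) = Y := by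
        ext z
        constructor
        · rintro ⟨p, hp, -, rfl⟩
          exact hp.2
        · exact fun hz => ⟨(val q 0, z), ⟨hq.1, hz⟩, rfl, rfl⟩
      have key (k : ℕ) := rankGE_fibre_coord (R := R) (n := k) (i := 0) (j := 1) (by simp) hZ
        (coord 0 q)
      simp only [hset, isLarge_iff, RankGE] at key
      refine le_antisymm ((key _).1 ⟨⟨q, hq, rfl⟩, le_rfl⟩).2 ((key _).2 ⟨⟨y, hy⟩, le_rfl⟩).2)
  refine ⟨hne, ?_⟩
  rw [h, himg]
  exact add_le_add hX.2 hY.2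

end RankFunction

end HomeSort

/-! ### Large subsets, connected components and Morley degree one. -/

namespace IsRankedGroup

open RankFunction Set.Definable

variable {L : Language} {G : Type*} [Group G] [L.Structure G] {R : RankFunction L G}
  {X Y : Set G} {n : ℕ}

theorem definable_mul_left (hG : IsRankedGroup L G) (hX : (Set.univ : Set G).Definable₁ L X)
    (a : G) : (Set.univ : Set G).Definable₁ L ((fun x => a * x) ⁻¹' X) :=
  setOf_mem hX (hG.definableFun_mul (Set.DefinableFun.const a) (Set.DefinableFun.proj L))

theorem isLarge_mul_left (hG : IsRankedGroup L G) (hX : (Set.univ : Set G).Definable₁ L X)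
    (a : G) : R.IsLarge n ((fun x => a * x) ⁻¹' X) ↔ R.IsLarge n X :=
  isLarge_preimage_equiv (e := Equiv.mulLeft a) hX
    (hG.definableFun_mul (Set.DefinableFun.const a) (Set.DefinableFun.proj L))

theorem isLarge_mul_right (hG : IsRankedGroup L G) (hX : (Set.univ : Set G).Definable₁ L X)
    (a : G) : R.IsLarge n ((fun x => x * a) ⁻¹' X) ↔ R.IsLarge n X :=
  isLarge_preimage_equiv (e := Equiv.mulRight a) hX
    (hG.definableFun_mul (Set.DefinableFun.proj L) (Set.DefinableFun.const a))

theorem rank_mul_right (hG : IsRankedGroup L G) {H : Subgroup G}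
    (hH : IsDefinableSubgroup L H) (a : G) :
    R.rank ((fun x => x * a) ⁻¹' (H : Set G)) = R.rank (H : Set G) := by
  have h (n : ℕ) := hG.isLarge_mul_right (R := R) (n := n) hH a
  have hne : ((fun x => x * a) ⁻¹' (H : Set G)).Nonempty := ⟨a⁻¹, by simp [H.one_mem]⟩
  simp only [isLarge_iff] at h
  exact le_antisymm ((h _).1 ⟨hne, le_rfl⟩).2 ((h _).2 ⟨⟨1, H.one_mem⟩, le_rfl⟩).2

theorem definable_inv (hG : IsRankedGroup L G) (hX : (Set.univ : Set G).Definable₁ L X) :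
    (Set.univ : Set G).Definable₁ L ((fun x => x⁻¹) ⁻¹' X) :=
  setOf_mem hX (hG.definableFun_inv (Set.DefinableFun.proj L))

theorem isLarge_inv (hG : IsRankedGroup L G) (hX : (Set.univ : Set G).Definable₁ L X) :
    R.IsLarge n ((fun x => x⁻¹) ⁻¹' X) ↔ R.IsLarge n X :=
  isLarge_preimage_equiv (e := Equiv.inv G) hX
    (hG.definableFun_inv (Set.DefinableFun.proj L))

/-- `H` is a finite union of translates of `K`, so one of them, hence `K`, is as large as `H`. -/
theorem isLarge_of_relIndex_ne_zero (hG : IsRankedGroup L G) {K H : Subgroup G}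
    (hK : IsDefinableSubgroup L K) (hH : IsDefinableSubgroup L H) (hKH : K.relIndex H ≠ 0)
    (h : R.IsLarge n (H : Set G)) : R.IsLarge n (K : Set G) := by
  have : Finite (H ⧸ K.subgroupOf H) := Nat.finite_of_card_ne_zero hKH
  have := Fintype.ofFinite (H ⧸ K.subgroupOf H)
  let F (q : H ⧸ K.subgroupOf H) : Set G := (fun x => (q.out : G)⁻¹ * x) ⁻¹' K
  have hF (q) : (Set.univ : Set G).Definable₁ L (F q) := hG.definable_mul_left hK _
  have hU : (Set.univ : Set G).Definable₁ L (⋃ q ∈ Finset.univ, F q) := definable_biUnion hF _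
  have hsub : (H : Set G) ⊆ ⋃ q ∈ Finset.univ, F q := fun x hx => by
    simp only [Finset.mem_univ, Set.iUnion_true, Set.mem_iUnion]
    refine ⟨(QuotientGroup.mk (⟨x, hx⟩ : H)), ?_⟩
    have := (QuotientGroup.mk (s := K.subgroupOf H) ⟨x, hx⟩).out_eq'
    exact (QuotientGroup.eq (a := Quotient.out _) (b := (⟨x, hx⟩ : H))).1 this
  obtain ⟨q, -, hq⟩ := (h.mono hH hU hsub).exists_of_biUnion hF
  exact (hG.isLarge_mul_left hK _).1 hq

theorem exists_seq_of_relIndex_eq_zero {K H : Subgroup G} (h : K.relIndex H = 0) :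
    ∃ g : ℕ → G, (∀ k, g k ∈ H) ∧ ∀ k l, k ≠ l → (g k)⁻¹ * g l ∉ K := by
  have : Infinite (H ⧸ K.subgroupOf H) := by
    by_contra hfin
    rw [not_infinite_iff_finite] at hfin
    exact Nat.card_pos.ne' h
  let e := Infinite.natEmbedding (H ⧸ K.subgroupOf H)
  refine ⟨fun k => (e k).out, fun k => (e k).out.2, fun k l hkl hm => hkl (e.injective ?_)⟩
  rw [← Quotient.out_eq' (e k), ← Quotient.out_eq' (e l)]
  exact QuotientGroup.eq.2 hm

/-- Infinitely many cosets of `K` would be disjoint subsets of `H` of full rank, pushing the rank of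
`H` up by one. -/
theorem relIndex_ne_zero_of_isLarge (hG : IsRankedGroup L G) {K H : Subgroup G}
    (hK : IsDefinableSubgroup L K) (hH : IsDefinableSubgroup L H) (hKH : K ≤ H)
    (h : R.IsLarge (R.rank (H : Set G)) (K : Set G)) : K.relIndex H ≠ 0 := by
  intro h0
  obtain ⟨g, hg, hgK⟩ := exists_seq_of_relIndex_eq_zero h0
  refine not_isLarge_rank_succ hH hH subset_rfl (isLarge_succ (R := R) hH
    (F := fun k => (fun x => (g k)⁻¹ * x) ⁻¹' K) (fun k => hG.definable_mul_left hK _)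
    (fun k => (hG.isLarge_mul_left hK _).2 h) (fun k x hx => ?_) fun k l hkl => ?_)
  · simpa using H.mul_mem (hg k) (hKH hx)
  · refine Set.disjoint_left.2 fun x hx hx' => hgK k l hkl ?_
    simpa using K.mul_mem hx (K.inv_mem hx')

theorem eq_of_isLarge (hG : IsRankedGroup L G) {K H : Subgroup G}
    (hK : IsDefinableSubgroup L K) (hH : IsDefinableSubgroup L H)
    (hHc : IsConnectedSubgroup L H) (hKH : K ≤ H)
    (h : R.IsLarge (R.rank (H : Set G)) (K : Set G)) : K = H :=
  hHc K hK hKH (hG.relIndex_ne_zero_of_isLarge hK hH hKH h)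

theorem subgroup_isLarge_rank (R : RankFunction L G) (H : Subgroup G) :
    R.IsLarge (R.rank (H : Set G)) (H : Set G) := isLarge_rank ⟨1, H.one_mem⟩

/-- A definable subgroup has a connected definable subgroup of finite index. -/
theorem exists_connected_finite_index (hG : IsRankedGroup L G) {D : Subgroup G}
    (hD : IsDefinableSubgroup L D) :
    ∃ K ≤ D, IsDefinableSubgroup L K ∧ IsConnectedSubgroup L K ∧ K.relIndex D ≠ 0 := by
  obtain ⟨R⟩ := hG.exists_rank
  by_contra! hcon
  let T := {K : Subgroup G // K ≤ D ∧ IsDefinableSubgroup L K ∧ K.relIndex D ≠ 0}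
  have step (K : T) : ∃ K' : T, K'.1 < K.1 := by
    have hnc : ¬ IsConnectedSubgroup L K.1 := fun h =>
      K.2.2.2 (hcon K.1 K.2.1 K.2.2.1 h)
    simp only [IsConnectedSubgroup, not_forall] at hnc
    obtain ⟨K', hK', hle, hidx, hne⟩ := hnc
    exact ⟨⟨K', hle.trans K.2.1, hK', Subgroup.relIndex_ne_zero_trans hidx K.2.2.2⟩,
      lt_of_le_of_ne hle hne⟩
  choose s hs using step
  let F (k : ℕ) : T := s^[k] ⟨D, le_rfl, hD, by simp⟩
  have hF (k) : (F (k + 1)).1 < (F k).1 := by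
    simp only [F, Function.iterate_succ_apply']
    exact hs _
  have hanti : Antitone fun k => (F k).1 := antitone_nat_of_succ_le fun k => (hF k).le
  -- With `x k` in the `k`-th group but not in the next, the cosets `x k * F (k + 1)` are pairwise
  -- disjoint and of full rank in `D`, which is impossible.
  choose x hx hx' using fun k => SetLike.exists_of_lt (hF k)
  have hsub (k) : (fun y => (x k)⁻¹ * y) ⁻¹' ((F (k + 1)).1 : Set G) ⊆ (F k).1 := fun y hy => by
    simpa using (F k).1.mul_mem (hx k) ((hF k).le hy)
  refine not_isLarge_rank_succ (R := R) hD hD subset_rfl (isLarge_succ hD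
    (F := fun k => (fun y => (x k)⁻¹ * y) ⁻¹' ((F (k + 1)).1 : Set G))
    (fun k => hG.definable_mul_left (F (k + 1)).2.2.1 _)
    (fun k => (hG.isLarge_mul_left (F (k + 1)).2.2.1 _).2
      (hG.isLarge_of_relIndex_ne_zero (F (k + 1)).2.2.1 hD (F (k + 1)).2.2.2
        (subgroup_isLarge_rank R D)))
    (fun k => (hsub k).trans (F k).2.1) ?_)
  refine (pairwise_disjoint_on _).2 fun k l hkl => Set.disjoint_left.2 fun y hy hy' => ?_
  have h1 : y ∈ (F (k + 1)).1 := hanti (Nat.succ_le_of_lt hkl) (hsub l hy')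
  refine hx' k ?_
  simpa using (F (k + 1)).1.mul_mem h1 ((F (k + 1)).1.inv_mem hy)

/-- The elements of `H` moving only a small part of `X` out of `X` form a definable subgroup `S`. It
has finite index, since translates of `X` by different cosets of `S` are almost disjoint, so
connectedness gives `S = H`. -/
theorem not_isLarge_of_irreducible (hG : IsRankedGroup L G) {H : Subgroup G}
    (hH : IsDefinableSubgroup L H) (hHc : IsConnectedSubgroup L H) (hXH : X ⊆ H)
    (hX : (Set.univ : Set G).Definable₁ L X) (hXn : R.IsLarge (R.rank (H : Set G)) X)
    (hirr : ∀ Z ⊆ X, (Set.univ : Set G).Definable₁ L Z → R.IsLarge (R.rank (H : Set G)) Z →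
      ¬ R.IsLarge (R.rank (H : Set G)) (X \ Z)) {g : G} (hg : g ∈ H) :
    ¬ R.IsLarge (R.rank (H : Set G)) {x | x ∈ X ∧ g * x ∉ X} := by
  set n := R.rank (H : Set G)
  have hin (a : G) : (Set.univ : Set G).Definable₁ L {x | x ∈ X ∧ a * x ∈ X} :=
    setOf_and hX (hG.definable_mul_left hX a)
  have hout (a : G) : (Set.univ : Set G).Definable₁ L {x | x ∈ X ∧ a * x ∉ X} :=
    setOf_and hX (setOf_not (hG.definable_mul_left hX a))
  have hin_of (a : G) (h : R.IsLarge n {x | x ∈ X ∧ a * x ∉ X}) :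
      ¬ R.IsLarge n {x | x ∈ X ∧ a * x ∈ X} := by
    have := hirr _ (fun x hx => hx.1) (hout a) h
    refine fun h' => this ?_
    convert h' using 1
    ext x
    simp only [Set.mem_sdiff, Set.mem_ofPred_eq]
    tauto
  let S : Subgroup G :=
    { carrier := {g | g ∈ H ∧ ¬ R.IsLarge n {x | x ∈ X ∧ g * x ∉ X}}
      one_mem' := ⟨H.one_mem, fun h => by
        obtain ⟨x, hx, hx'⟩ := h.nonempty
        exact hx' (by rwa [one_mul])⟩
      mul_mem' := by
        rintro a b ⟨ha, ha'⟩ ⟨hb, hb'⟩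
        refine ⟨H.mul_mem ha hb, fun h => ?_⟩
        have h1 := h.mono (hout _) ((hout b).union (hG.definable_mul_left (hout a) b))
          (Y := {x | x ∈ X ∧ b * x ∉ X} ∪ (fun x => b * x) ⁻¹' {x | x ∈ X ∧ a * x ∉ X})
          (fun x hx => by
            by_cases hbx : b * x ∈ X
            · exact Or.inr ⟨hbx, by rw [← mul_assoc]; exact hx.2⟩
            · exact Or.inl ⟨hx.1, hbx⟩)
        rcases h1.or_of_union (hout b) (hG.definable_mul_left (hout a) b) with h | h
        · exact hb' h
        · exact ha' ((hG.isLarge_mul_left (hout a) b).1 h)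
      inv_mem' := by
        rintro a ⟨ha, ha'⟩
        refine ⟨H.inv_mem ha, fun h => ?_⟩
        -- If `a⁻¹` fails, X ∩ aX is small, and so is its translate X ∩ a⁻¹X. As X \ a⁻¹X is small
        -- too, `X` would be small.
        have h1 := hin_of _ h
        rw [← hG.isLarge_mul_left (hin _) a] at h1
        have h2 := hXn.mono hX ((hG.definable_mul_left (hin _) a).union (hout a))
          (Y := (fun x => a * x) ⁻¹' {x | x ∈ X ∧ a⁻¹ * x ∈ X} ∪ {x | x ∈ X ∧ a * x ∉ X})
          (fun x hx => by
            by_cases hax : a * x ∈ X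
            · exact Or.inl ⟨hax, by rwa [inv_mul_cancel_left]⟩
            · exact Or.inr ⟨hx, hax⟩)
        rcases h2.or_of_union (hG.definable_mul_left (hin _) a) (hout a) with h | h
        · exact h1 h
        · exact ha' h }
  have hS : IsDefinableSubgroup L S := by
    refine setOf_and hH (setOf_not ?_)
    refine definable_isLarge_fibre (Z := {p | p.2 ∈ X ∧ p.1 * p.2 ∉ X}) ?_ R n
    exact setOf_and (setOf_mem hX (Set.DefinableFun.proj L)) (setOf_not (setOf_mem hX
      (hG.definableFun_mul (Set.DefinableFun.proj L) (Set.DefinableFun.proj L))))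
  suffices S = H from (this ▸ hg : g ∈ S).2
  refine hHc S hS (fun x hx => hx.1) fun h0 => ?_
  obtain ⟨a, haH, haS⟩ := exists_seq_of_relIndex_eq_zero h0
  let T (k : ℕ) : Set G := (fun x => (a k)⁻¹ * x) ⁻¹' X
  have hT (k) : (Set.univ : Set G).Definable₁ L (T k) := hG.definable_mul_left hX _
  have hTT (k l) : (Set.univ : Set G).Definable₁ L (T k ∩ T l) := (hT k).inter (hT l)
  have hsmall (k l) (hkl : k ≠ l) : ¬ R.IsLarge n (T l ∩ T k) := by
    have h1 : R.IsLarge n {x | x ∈ X ∧ ((a k)⁻¹ * a l) * x ∉ X} := by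
      by_contra h
      exact haS k l hkl ⟨H.mul_mem (H.inv_mem (haH k)) (haH l), h⟩
    have h2 := hin_of _ h1
    rw [← hG.isLarge_mul_left (hin _) (a l)⁻¹] at h2
    convert h2 using 2
    ext x
    simp [T, mul_assoc]
  have hU (k : ℕ) {F : ℕ → Set G} (hF : ∀ j, (Set.univ : Set G).Definable₁ L (F j)) :
      (Set.univ : Set G).Definable₁ L (⋃ j ∈ Finset.range k, F j) :=
    definable_biUnion hF _
  -- Removing the earlier translates costs only small sets, so these disjoint remainders are still
  -- large.
  have hY (k) : (Set.univ : Set G).Definable₁ L (T k \ ⋃ j ∈ Finset.range k, T j) :=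
    (hT k).sdiff (hU k hT)
  refine not_isLarge_rank_succ hH hH subset_rfl (isLarge_succ (R := R) hH
    (F := fun k => T k \ ⋃ j ∈ Finset.range k, T j) hY (fun k => ?_) (fun k x hx => ?_) ?_)
  · have h1 : R.IsLarge n (T k) := (hG.isLarge_mul_left hX _).2 hXn
    have h2 := h1.mono (hT k) ((hY k).union (hU k (hTT k)))
      (Y := (T k \ ⋃ j ∈ Finset.range k, T j) ∪ ⋃ j ∈ Finset.range k, T k ∩ T j)
      (fun x hx => by
        by_cases h : x ∈ ⋃ j ∈ Finset.range k, T j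
        · exact Or.inr (by rw [← Set.inter_iUnion₂]; exact ⟨hx, h⟩)
        · exact Or.inl ⟨hx, h⟩)
    refine (h2.or_of_union (hY k) (hU k (hTT k))).resolve_right fun h => ?_
    obtain ⟨j, hj, h⟩ := h.exists_of_biUnion (hTT k)
    exact hsmall j k (Finset.mem_range.1 hj).ne h
  · simpa using H.mul_mem (haH k) (hXH hx.1)
  · refine (pairwise_disjoint_on _).2 fun k l hkl => Set.disjoint_left.2 fun y hy hy' => ?_
    exact hy'.2 (Set.mem_biUnion (Finset.mem_range.2 hkl) hy.1)

/-- A connected definable subgroup has Morley degree one. -/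
theorem inter_nonempty_of_isLarge (hG : IsRankedGroup L G) {H : Subgroup G}
    (hH : IsDefinableSubgroup L H) (hHc : IsConnectedSubgroup L H) (hXH : X ⊆ H) (hYH : Y ⊆ H)
    (hX : (Set.univ : Set G).Definable₁ L X) (hY : (Set.univ : Set G).Definable₁ L Y)
    (hXn : R.IsLarge (R.rank (H : Set G)) X) (hYn : R.IsLarge (R.rank (H : Set G)) Y) :
    (X ∩ Y).Nonempty := by
  set n := R.rank (H : Set G) with hn
  -- Inverting `X` turns the conditions y⁻¹x ∈ X⁻¹ and x⁻¹y ∈ Y into membership of the single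
  -- element x⁻¹y in `X ∩ Y`.
  have hXi : (fun x => x⁻¹) ⁻¹' X ⊆ (H : Set G) := fun x hx => by simpa using H.inv_mem (hXH hx)
  obtain ⟨X', hX'X, hX', hX'n, hX'i⟩ := ((hG.isLarge_inv hX).2 hXn).exists_irreducible
    (hG.definable_inv hX) (not_isLarge_rank_succ (hG.definable_inv hX) hH hXi)
  obtain ⟨Y', hY'Y, hY', hY'n, hY'i⟩ := hYn.exists_irreducible hY (not_isLarge_rank_succ hY hH hYH)
  have hXs {g : G} (hg : g ∈ H) := hG.not_isLarge_of_irreducible hH hHc (hX'X.trans hXi) hX' hX'n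
    hX'i hg
  have hYs {g : G} (hg : g ∈ H) := hG.not_isLarge_of_irreducible hH hHc (hY'Y.trans hYH) hY' hY'n
    hY'i hg
  by_contra hemp
  -- If `X ∩ Y` is empty, each pair of `X' ×ˢ Y'` is bad on one side and lies in `P` or `Q`. Each
  -- fibre of `P` over `X'` and of `Q` over `Y'` is small by almost-invariance, so neither set
  -- reaches the rank 2n of the product.
  let P : Set (G × G) := {p | (p.1 ∈ X' ∧ p.2 ∈ Y') ∧ p.1⁻¹ * p.2 ∉ Y'}
  let Q : Set (G × G) := {p | (p.1 ∈ X' ∧ p.2 ∈ Y') ∧ p.2⁻¹ * p.1 ∉ X'}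
  have hXY := definable_prod hX' hY'
  have hP : (Set.univ : Set G).Definable₂ L P := setOf_and hXY (setOf_not (setOf_mem hY'
    (hG.definableFun_mul (hG.definableFun_inv (Set.DefinableFun.proj L))
      (Set.DefinableFun.proj L))))
  have hQ : (Set.univ : Set G).Definable₂ L Q := setOf_and hXY (setOf_not (setOf_mem hX'
    (hG.definableFun_mul (hG.definableFun_inv (Set.DefinableFun.proj L))
      (Set.DefinableFun.proj L))))
  have hcover : X' ×ˢ Y' ⊆ P ∪ Q := by
    rintro ⟨x, y⟩ hxy
    by_contra hnot
    simp only [P, Q, Set.mem_union, Set.mem_ofPred_eq, not_or, not_and, not_not] at hnot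
    have h1 := hnot.1 hxy
    have h2 := hnot.2 hxy
    refine hemp ⟨x⁻¹ * y, ?_, hY'Y h1⟩
    simpa using hX'X h2
  have hlarge := (rankGE_prod hX'n hY'n hX' hY').mono (homeSort.isDefinable_pair hXY)
    ((homeSort.isDefinable_pair hP).union (homeSort.isDefinable_pair hQ)) (Set.preimage_mono hcover)
  rcases hlarge.or_of_union (homeSort.isDefinable_pair hP) (homeSort.isDefinable_pair hQ) with h | h
  · refine not_rankGE_of_pairFibre (i := 0) (j := 1) (by simp) hP hX' (fun p hp => hp.1.1)
      (rank_mono hX' hH hX'n.nonempty (hX'X.trans hXi)) (fun b hb hl => ?_) h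
    refine hYs (H.inv_mem (hXi (hX'X hb))) ?_
    convert hl using 1
    ext y
    constructor
    · exact fun hy => ⟨(b, y), ⟨⟨hb, hy.1⟩, hy.2⟩, rfl, rfl⟩
    · rintro ⟨⟨p, q⟩, hp, rfl, rfl⟩
      exact ⟨hp.1.2, hp.2⟩
  · refine not_rankGE_of_pairFibre (i := 1) (j := 0) (by simp) hQ hY' (fun p hp => hp.1.2)
      (rank_mono hY' hH hY'n.nonempty (hY'Y.trans hYH)) (fun b hb hl => ?_) h
    refine hXs (H.inv_mem (hYH (hY'Y hb))) ?_
    convert hl using 1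
    ext x
    constructor
    · exact fun hx => ⟨(x, b), ⟨⟨hx.1, hb⟩, hx.2⟩, rfl, rfl⟩
    · rintro ⟨⟨p, q⟩, hp, rfl, rfl⟩
      exact ⟨hp.1.1, hp.2⟩

/-- Otherwise `X \ Y` would be large and disjoint from the large set `Y`. -/
theorem isLarge_inter (hG : IsRankedGroup L G) {H : Subgroup G}
    (hH : IsDefinableSubgroup L H) (hHc : IsConnectedSubgroup L H) (hXH : X ⊆ H) (hYH : Y ⊆ H)
    (hX : (Set.univ : Set G).Definable₁ L X) (hY : (Set.univ : Set G).Definable₁ L Y)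
    (hXn : R.IsLarge (R.rank (H : Set G)) X) (hYn : R.IsLarge (R.rank (H : Set G)) Y) :
    R.IsLarge (R.rank (H : Set G)) (X ∩ Y) := by
  have hd : (Set.univ : Set G).Definable₁ L (X ∩ Y) := hX.inter hY
  have hd' : (Set.univ : Set G).Definable₁ L (X \ Y) := hX.sdiff hY
  have h := hXn
  rw [← Set.inter_union_sdiff X Y] at h
  refine (h.or_of_union hd hd').resolve_right fun h => ?_
  obtain ⟨x, hx, hx'⟩ := hG.inter_nonempty_of_isLarge hH hHc (Set.sdiff_subset.trans hXH) hYH hd'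
    hY h hYn
  exact hx.2 hx'

/-! ### Involutions acting with finitely many fixed points. -/

theorem definable_conj_eq_inv (hG : IsRankedGroup L G) {H : Subgroup G}
    (hH : IsDefinableSubgroup L H) (i : G) :
    (Set.univ : Set G).Definable₁ L {h | h ∈ H ∧ i * h * i = h⁻¹} :=
  setOf_and hH (setOf_eq (hG.definableFun_mul (hG.definableFun_mul (Set.DefinableFun.const _)
    (Set.DefinableFun.proj L)) (Set.DefinableFun.const _))
    (hG.definableFun_inv (Set.DefinableFun.proj L)))

theorem definable_centralizer (hG : IsRankedGroup L G) {X : Set G}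
    (hX : (Set.univ : Set G).Definable₁ L X) :
    IsDefinableSubgroup L (Subgroup.centralizer X) := by
  have : (Set.univ : Set G).Definable L {v : Fin 1 → G | ∀ x, x ∈ X → x * v 0 = v 0 * x} :=
    setOf_forall (setOf_imp (setOf_mem hX (Set.DefinableFun.proj L)) (setOf_eq
      (hG.definableFun_mul (Set.DefinableFun.proj L) (Set.DefinableFun.proj L))
      (hG.definableFun_mul (Set.DefinableFun.proj L) (Set.DefinableFun.proj L))))
  exact this

theorem definable_inf {H K : Subgroup G} (hH : IsDefinableSubgroup L H)
    (hK : IsDefinableSubgroup L K) : IsDefinableSubgroup L (H ⊓ K) :=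
  Set.Definable.inter hH hK

theorem definableFun_commutator (hG : IsRankedGroup L G) (i : G) {α : Type*} (a : α) :
    (Set.univ : Set G).DefinableFun L fun v : α → G => (v a)⁻¹ * (i * v a * i) :=
  hG.definableFun_mul (hG.definableFun_inv (Set.DefinableFun.proj L))
    (hG.definableFun_mul (hG.definableFun_mul (Set.DefinableFun.const _)
      (Set.DefinableFun.proj L)) (Set.DefinableFun.const _))

/-- Identifies the fibres of `x ↦ x⁻¹ * (i * x * i)`: two elements of a fibre lie in the same right
coset of the centralizer of `i`. -/
theorem mul_inv_commute_of_commutator_eq {i x y : G} (hi : i * i = 1)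
    (h : y⁻¹ * (i * y * i) = x⁻¹ * (i * x * i)) : i * (y * x⁻¹) = y * x⁻¹ * i := by
  have hii (x : G) : i * (i * x) = x := by rw [← mul_assoc, hi, one_mul]
  have h' : i * y * i = y * x⁻¹ * (i * x * i) := by
    rw [mul_assoc y, ← h, mul_inv_cancel_left]
  calc i * (y * x⁻¹) = (i * y * i) * (i * x⁻¹) := by simp only [mul_assoc, hii]
    _ = y * x⁻¹ * i * (x * (i * (i * x⁻¹))) := by rw [h']; simp only [mul_assoc]
    _ = y * x⁻¹ * i := by simp [hii]

/-- An involution acting on a connected definable subgroup with finitely many fixed points acts by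
inversion. -/
theorem conj_eq_inv_of_finite (hG : IsRankedGroup L G) {H : Subgroup G}
    (hH : IsDefinableSubgroup L H) (hHc : IsConnectedSubgroup L H) {i : G} (hi : i * i = 1)
    (hiH : ∀ h ∈ H, i * h * i ∈ H) (hfin : {h | h ∈ H ∧ i * h = h * i}.Finite) {h : G}
    (hh : h ∈ H) : i * h * i = h⁻¹ := by
  obtain ⟨R⟩ := hG.exists_rank
  have hi' : i⁻¹ = i := inv_eq_of_mul_eq_one_left hi
  have hii (x : G) : i * (i * x) = x := by rw [← mul_assoc, hi, one_mul]
  let X : Set G := {h | h ∈ H ∧ i * h * i = h⁻¹}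
  have hX : (Set.univ : Set G).Definable₁ L X := hG.definable_conj_eq_inv hH i
  have hXH : X ⊆ H := fun x hx => hx.1
  -- The map `x ↦ x⁻¹ * (i * x * i)` takes values in `X` and has finite fibres on `H`, so its image
  -- already has full rank.
  have hXn : R.IsLarge (R.rank (H : Set G)) X := by
    have hgraph : (Set.univ : Set G).Definable₂ L
        {p | p.1 ∈ (H : Set G) ∧ p.1⁻¹ * (i * p.1 * i) = p.2} :=
      setOf_and (setOf_mem hH (Set.DefinableFun.proj L))
        (setOf_eq (hG.definableFun_commutator i 0) (Set.DefinableFun.proj L))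
    have h1 : R.IsLarge (R.rank (H : Set G)) ((fun x => x⁻¹ * (i * x * i)) '' (H : Set G)) := by
      refine (isLarge_image hH hgraph fun x hx => ?_).2 (subgroup_isLarge_rank R H)
      refine (hfin.image fun y => y * x).subset fun y hy => ⟨y * x⁻¹, ⟨?_, ?_⟩, by simp⟩
      · exact H.mul_mem hy.1 (H.inv_mem hx)
      · exact mul_inv_commute_of_commutator_eq hi hy.2
    refine h1.mono (definable_image hgraph) hX ?_
    rintro _ ⟨x, hx, rfl⟩
    refine ⟨H.mul_mem (H.inv_mem hx) (hiH x hx), ?_⟩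
    simp only [mul_inv_rev, inv_inv, hi', mul_assoc, hi, mul_one]
  -- If `a`, `x` and `a * x` are all inverted, then `a` and `x` commute. By degree one this holds
  -- for a large set of `x`, so the centralizer of `a` in `H` is everything.
  have hcentral (a : G) (ha : a ∈ X) : H ≤ Subgroup.centralizer {a} := by
    have hK : IsDefinableSubgroup L (H ⊓ Subgroup.centralizer {a}) :=
      definable_inf hH (hG.definable_centralizer (Set.Definable.singleton_of_mem L trivial))
    have haX : (fun x => a * x) ⁻¹' X ⊆ (H : Set G) := fun x hx => by
      simpa using H.mul_mem (H.inv_mem ha.1) hx.1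
    have hint := hG.isLarge_inter hH hHc hXH haX hX (hG.definable_mul_left hX a) hXn
      ((hG.isLarge_mul_left hX a).2 hXn)
    have := hG.eq_of_isLarge hK hH hHc inf_le_left (hint.mono
      (hX.inter (hG.definable_mul_left hX a)) hK fun x hx => ⟨hx.1.1, ?_⟩)
    · exact inf_eq_left.1 this
    · have h1 : i * (a * x) * i = (a * x)⁻¹ := hx.2.2
      have h2 : i * (a * x) * i = (i * a * i) * (i * x * i) := by simp only [mul_assoc, hii]
      rw [h2, ha.2, hx.1.2, ← mul_inv_rev, inv_inj] at h1
      exact Subgroup.mem_centralizer_singleton_iff.2 h1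
  have hcomm : H ≤ Subgroup.centralizer H := by
    have hK := definable_inf hH (hG.definable_centralizer hH)
    refine inf_eq_left.1 (hG.eq_of_isLarge hK hH hHc inf_le_left (hXn.mono hX hK fun x hx =>
      ⟨hx.1, fun y hy => ?_⟩))
    exact (Subgroup.mem_centralizer_singleton_iff.1 (hcentral x hx hy))
  -- Now that `H` is abelian, the inverted elements form a subgroup; being large, it is `H`.
  let K : Subgroup G :=
    { carrier := X
      one_mem' := ⟨H.one_mem, by simp [hi]⟩
      mul_mem' := by
        rintro a b ⟨ha, ha'⟩ ⟨hb, hb'⟩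
        refine ⟨H.mul_mem ha hb, ?_⟩
        calc i * (a * b) * i = (i * a * i) * (i * b * i) := by simp only [mul_assoc, hii]
          _ = (a * b)⁻¹ := by rw [ha', hb', ← mul_inv_rev, hcomm hb a ha]
      inv_mem' := by
        rintro a ⟨ha, ha'⟩
        refine ⟨H.inv_mem ha, ?_⟩
        calc i * a⁻¹ * i = (i * a * i)⁻¹ := by simp only [mul_inv_rev, hi', mul_assoc]
          _ = a⁻¹⁻¹ := by rw [ha'] }
  have hKH : K = H := hG.eq_of_isLarge (K := K) hX hH hHc hXH hXn
  exact (hKH ▸ hh : h ∈ K).2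

end IsRankedGroup

/-! ### Consequences of the TI and finite index conditions. -/

namespace IsQuasiFrobenius

variable {G : Type*} [Group G] {C : Subgroup G}

/-- Such an `x` is its own conjugate by `g`, hence a nontrivial element of both `C` and its
conjugate. -/
theorem mem_normalizer_of_commute (hC : IsQuasiFrobenius C) {x g : G} (hx : x ∈ C) (hx1 : x ≠ 1)
    (h : x * g = g * x) : g ∈ Subgroup.normalizer (C : Set G) := by
  by_contra hg
  refine hx1 ?_
  rw [← Subgroup.mem_bot, ← hC.ti g hg]
  refine ⟨⟨x, hx, ?_⟩, hx⟩
  simp [mul_assoc, h]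

/-- A subgroup of the normalizer meeting `C` trivially has order its index over `C`, which is
finite. -/
theorem finite_inf_normalizer (hC : IsQuasiFrobenius C) {A : Subgroup G} (hA : A ⊓ C = ⊥) :
    ((A ⊓ Subgroup.normalizer (C : Set G) : Subgroup G) : Set G).Finite := by
  set N := Subgroup.normalizer (C : Set G)
  have h : C.relIndex (A ⊓ N) ≠ 0 := fun h0 =>
    hC.finite_index (Subgroup.relIndex_eq_zero_of_le_right inf_le_right h0)
  have hbot : C ⊓ (A ⊓ N) = ⊥ := by
    rw [← inf_assoc, inf_comm C, hA, bot_inf_eq]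
  rw [← Subgroup.inf_relIndex_right, hbot, Subgroup.relIndex_bot_left] at h
  exact Nat.finite_of_card_ne_zero h

theorem finite_commuting (hC : IsQuasiFrobenius C) {A : Subgroup G} (hA : A ⊓ C = ⊥) {x : G}
    (hx : x ∈ C) (hx1 : x ≠ 1) : {a | a ∈ A ∧ x * a = a * x}.Finite :=
  (hC.finite_inf_normalizer hA).subset fun _ ha =>
    ⟨ha.1, hC.mem_normalizer_of_commute hx hx1 ha.2⟩

/-- A nontrivial element of `C` commutes with only finitely many elements of `A`. -/
theorem centralizer_inf_eq_bot (hC : IsQuasiFrobenius C) {A : Subgroup G} (hA : A ⊓ C = ⊥)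
    (hAinf : (A : Set G).Infinite) : Subgroup.centralizer (A : Set G) ⊓ C = ⊥ := by
  refine (Subgroup.eq_bot_iff_forall _).2 fun x hx => ?_
  by_contra hx1
  exact hAinf ((hC.finite_commuting hA hx.2 hx1).subset fun a ha => ⟨ha, (hx.1 a ha).symm⟩)

end IsQuasiFrobenius

/-! ### Normalizers, semidirect products and the commutator map. -/

namespace IsRankedGroup

open RankFunction Set.Definable

variable {L : Language} {G : Type*} [Group G] [L.Structure G] {R : RankFunction L G}

theorem definable_normalizer (hG : IsRankedGroup L G) {C : Subgroup G}
    (hC : IsDefinableSubgroup L C) :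
    IsDefinableSubgroup L (Subgroup.normalizer (C : Set G)) := by
  have h1 : (Set.univ : Set G).DefinableFun L
      (fun v : Fin 1 ⊕ Fin 1 → G => v (Sum.inl 0) * v (Sum.inr 0) * (v (Sum.inl 0))⁻¹) :=
    hG.definableFun_mul (hG.definableFun_mul (Set.DefinableFun.proj L) (Set.DefinableFun.proj L))
      (hG.definableFun_inv (Set.DefinableFun.proj L))
  have h2 := setOf_mem hC (Set.DefinableFun.proj L (i := (Sum.inr 0 : Fin 1 ⊕ Fin 1)))
  have h3 := setOf_mem hC h1
  have : (Set.univ : Set G).Definable L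
      {v : Fin 1 → G | ∀ x, (x ∈ C → v 0 * x * (v 0)⁻¹ ∈ C) ∧ (v 0 * x * (v 0)⁻¹ ∈ C → x ∈ C)} :=
    setOf_forall (setOf_and (setOf_imp h2 h3) (setOf_imp h3 h2))
  refine (congrArg (Set.univ.Definable L) ?_).mpr this
  ext v
  exact forall_congr' fun x => ⟨fun h => ⟨h.1, h.2⟩, fun h => ⟨h.1, h.2⟩⟩

/-- The connected component of a normal subgroup is normal. -/
theorem normal_of_connected_finite_index (hG : IsRankedGroup L G) {K D : Subgroup G} [D.Normal]
    (hKD : K ≤ D) (hK : IsDefinableSubgroup L K) (hKc : IsConnectedSubgroup L K)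
    (hKi : K.relIndex D ≠ 0) : K.Normal := by
  refine ⟨fun x hx g => ?_⟩
  -- `K'` is a conjugate of `K`, again of finite index in the normal subgroup `D`; so `K ⊓ K'` has
  -- finite index in the connected `K`, and `K ≤ K'`.
  let K' : Subgroup G := K.comap (MulAut.conj g).toMonoidHom
  have hK' : IsDefinableSubgroup L K' := setOf_mem hK (hG.definableFun_mul (hG.definableFun_mul
    (Set.DefinableFun.const g) (Set.DefinableFun.proj L)) (Set.DefinableFun.const g⁻¹))
  have hDmap : D.map (MulAut.conj g).toMonoidHom = D :=
    Subgroup.Normal.map_conj_eq D g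
  have hidx : K'.relIndex D ≠ 0 := by
    rw [Subgroup.relIndex_comap, hDmap]
    exact hKi
  have hidx' : (K ⊓ K').relIndex K ≠ 0 := by
    rw [Subgroup.inf_relIndex_left]
    exact fun h0 => hidx (Subgroup.relIndex_eq_zero_of_le_right hKD h0)
  have := hKc (K ⊓ K') (definable_inf hK hK') inf_le_left hidx'
  exact (inf_eq_left.1 this) hx

/-- The product of a normal subgroup `A` with a subgroup `C` that meets it trivially is definable, of
rank `rk A + rk C`. -/
theorem rank_sup_of_inf_eq_bot (hG : IsRankedGroup L G) {A C : Subgroup G} [A.Normal]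
    (hA : IsDefinableSubgroup L A) (hC : IsDefinableSubgroup L C) (hAC : A ⊓ C = ⊥)
    (R : RankFunction L G) :
    IsDefinableSubgroup L (A ⊔ C) ∧
      R.rank ((A ⊔ C : Subgroup G) : Set G) = R.rank (A : Set G) + R.rank (C : Set G) := by
  have hmem (g : G) : g ∈ A ⊔ C ↔ ∃ c ∈ C, g * c⁻¹ ∈ A := by
    rw [Subgroup.mem_sup_of_normal_left]
    constructor
    · rintro ⟨a, ha, c, hc, rfl⟩
      exact ⟨c, hc, by simpa using ha⟩
    · rintro ⟨c, hc, h⟩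
      exact ⟨_, h, c, hc, by simp⟩
  have huniq {g c c' : G} (hc : c ∈ C) (hc' : c' ∈ C) (h : g * c⁻¹ ∈ A) (h' : g * c'⁻¹ ∈ A) :
      c = c' := by
    have h1 : c * c'⁻¹ ∈ A ⊓ C := by
      refine ⟨?_, C.mul_mem hc (C.inv_mem hc')⟩
      simpa [mul_assoc] using A.mul_mem (A.inv_mem h) h'
    rw [hAC, Subgroup.mem_bot] at h1
    exact mul_inv_eq_one.1 h1
  classical
  -- The projection `a * c ↦ c`, with junk value 1 off `A ⊔ C`. Its fibres are cosets of `A`, which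
  -- gives the rank formula.
  let φ (g : G) : G := if h : ∃ c ∈ C, g * c⁻¹ ∈ A then h.choose else 1
  have hφ {g c : G} (hc : c ∈ C) (h : g * c⁻¹ ∈ A) : φ g = c := by
    have hex : ∃ c ∈ C, g * c⁻¹ ∈ A := ⟨c, hc, h⟩
    simp only [φ, dif_pos hex]
    exact huniq hex.choose_spec.1 hc hex.choose_spec.2 h
  have hgraph : (Set.univ : Set G).Definable₂ L
      {p | p.1 ∈ ((A ⊔ C : Subgroup G) : Set G) ∧ φ p.1 = p.2} := by
    have : (Set.univ : Set G).Definable₂ L {p | p.2 ∈ C ∧ p.1 * p.2⁻¹ ∈ A} :=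
      setOf_and (setOf_mem hC (Set.DefinableFun.proj L)) (setOf_mem hA (hG.definableFun_mul
        (Set.DefinableFun.proj L) (hG.definableFun_inv (Set.DefinableFun.proj L))))
    refine (congrArg (Set.univ.Definable₂ L) ?_).mpr this
    ext ⟨g, c⟩
    constructor
    · rintro ⟨h1, h2⟩
      obtain ⟨c', hc, h⟩ := (hmem g).1 h1
      obtain rfl : c' = c := (hφ hc h).symm.trans h2
      exact ⟨hc, h⟩
    · rintro ⟨hc, h⟩
      exact ⟨(hmem g).2 ⟨c, hc, h⟩, hφ hc h⟩
  have hdef : IsDefinableSubgroup L (A ⊔ C) := by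
    have : (Set.univ : Set G).Definable L {v : Fin 1 → G | ∃ c, c ∈ C ∧ v 0 * c⁻¹ ∈ A} :=
      setOf_exists (setOf_and (setOf_mem hC (Set.DefinableFun.proj L)) (setOf_mem hA
        (hG.definableFun_mul (Set.DefinableFun.proj L)
          (hG.definableFun_inv (Set.DefinableFun.proj L)))))
    refine (congrArg (Set.univ.Definable L) ?_).mpr this
    ext v
    exact hmem (v 0)
  refine ⟨hdef, ?_⟩
  have himg : φ '' ((A ⊔ C : Subgroup G) : Set G) = C := by
    ext c
    constructor
    · rintro ⟨g, hg, rfl⟩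
      obtain ⟨c, hc, h⟩ := (hmem g).1 hg
      rwa [hφ hc h]
    · exact fun hc => ⟨c, (hmem c).2 ⟨c, hc, by simp⟩, hφ hc (by simp)⟩
  have h := RankFunction.rank_eq_add_of_fibres (R := R) (n := R.rank (A : Set G)) hdef hgraph
    ⟨1, one_mem _⟩ (fun g hg => by
      obtain ⟨c, hc, h⟩ := (hmem g).1 hg
      rw [← hG.rank_mul_right hA c⁻¹]
      congr 1
      ext x
      simp only [hφ hc h]
      constructor
      · rintro ⟨hx, hx'⟩
        obtain ⟨c', hc', h'⟩ := (hmem x).1 hx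
        have : c' = c := (hφ hc' h').symm.trans hx'
        exact this ▸ h'
      · exact fun hx => ⟨(hmem x).2 ⟨c, hc, hx⟩, hφ hc hx⟩)
  rw [h, himg, add_comm]

/-- The rank of a group is at most the rank of a subgroup containing all `g⁻¹ * i * g * i` plus the
rank of a subgroup that contains the centralizer of the involution `i`. -/
theorem rank_le_of_commutator_mem (hG : IsRankedGroup L G) {D N : Subgroup G}
    (hD : IsDefinableSubgroup L D) (hN : IsDefinableSubgroup L N) {i : G} (hi : i * i = 1)
    (hiD : ∀ g, g⁻¹ * (i * g * i) ∈ D) (hiN : Subgroup.centralizer {i} ≤ N)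
    (R : RankFunction L G) :
    R.rank ((⊤ : Subgroup G) : Set G) ≤ R.rank (D : Set G) + R.rank (N : Set G) := by
  have hT : IsDefinableSubgroup L (⊤ : Subgroup G) := Set.definable_univ
  have hZ : IsDefinableSubgroup L (Subgroup.centralizer {i}) :=
    hG.definable_centralizer (Set.Definable.singleton_of_mem L trivial)
  have hgraph : (Set.univ : Set G).Definable₂ L
      {p | p.1 ∈ ((⊤ : Subgroup G) : Set G) ∧ p.1⁻¹ * (i * p.1 * i) = p.2} :=
    setOf_and (setOf_mem hT (Set.DefinableFun.proj L))
      (setOf_eq (hG.definableFun_commutator i 0) (Set.DefinableFun.proj L))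
  have h := RankFunction.rank_eq_add_of_fibres (R := R)
    (n := R.rank (Subgroup.centralizer {i} : Set G)) hT hgraph ⟨1, trivial⟩ (fun x _ => by
      rw [← hG.rank_mul_right hZ x⁻¹]
      congr 1
      ext y
      change (True ∧ y⁻¹ * (i * y * i) = x⁻¹ * (i * x * i)) ↔
        y * x⁻¹ ∈ Subgroup.centralizer {i}
      rw [Subgroup.mem_centralizer_singleton_iff, true_and]
      constructor
      · exact fun h => (mul_inv_commute_of_commutator_eq hi h).symm
      · intro h2
        have h3 : i * y = y * x⁻¹ * i * x := by rw [h2]; simp [mul_assoc]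
        rw [h3]
        simp [mul_assoc])
  rw [h]
  refine add_le_add (rank_mono (definable_image hgraph) hD ⟨_, 1, trivial, rfl⟩ ?_)
    (rank_mono hZ hN ⟨1, one_mem _⟩ hiN)
  rintro _ ⟨x, -, rfl⟩
  exact hiD x

end IsRankedGroup

/-! ### The proposition. -/

theorem mainTheorem7 (L : FirstOrder.Language) (G : Type*) [Group G] [L.Structure G]
    (hG : IsRankedGroup L G) (hGconn : IsConnectedSubgroup L (⊤ : Subgroup G))
    (C : Subgroup G) (hC : IsQuasiFrobenius C) (hCdef : IsDefinableSubgroup L C)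
    (hinv : ∃ i : G, orderOf i = 2)
    (hinvC : ∀ i : G, orderOf i = 2 → ∃ g : G, i ∈ conjSubgroup C g)
    (hA : ∃ A : Subgroup G, IsDefinableSubgroup L A ∧ IsConnectedSubgroup L A ∧ A.Normal ∧
      (A : Set G).Infinite ∧ A ⊓ C = ⊥) :
    ∃ A₁ : Subgroup G, IsDefinableSubgroup L A₁ ∧ IsConnectedSubgroup L A₁ ∧
      IsMulCommutative A₁ ∧ A₁.Normal ∧ A₁.IsComplement' C := by
  obtain ⟨A, hAdef, hAconn, hAnormal, hAinf, hAC⟩ := hA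
  obtain ⟨i, hiC, hi, hi1⟩ : ∃ i ∈ C, i * i = 1 ∧ i ≠ 1 := by
    obtain ⟨j, hj⟩ := hinv
    obtain ⟨g, c, hc, rfl⟩ := hinvC j hj
    refine ⟨c, hc, ?_, ?_⟩
    · have h2 := pow_orderOf_eq_one ((MulAut.conj g⁻¹).toMonoidHom c)
      rw [hj, ← map_pow] at h2
      rw [← sq]
      exact (MulAut.conj g⁻¹).injective (h2.trans (map_one _).symm)
    · rintro rfl
      simp at hj
  have hi' : i⁻¹ = i := inv_eq_of_mul_eq_one_left hi
  have hstab (B : Subgroup G) (hB : B.Normal) (b : G) (hb : b ∈ B) : i * b * i ∈ B := by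
    simpa [hi'] using hB.conj_mem b hb i
  have hAinv (a : G) (ha : a ∈ A) : i * a * i = a⁻¹ :=
    hG.conj_eq_inv_of_finite hAdef hAconn hi (hstab A hAnormal)
      (hC.finite_commuting hAC hiC hi1) ha
  set D := Subgroup.centralizer (A : Set G)
  have hDdef : IsDefinableSubgroup L D := hG.definable_centralizer hAdef
  have hDC : D ⊓ C = ⊥ := hC.centralizer_inf_eq_bot hAC hAinf
  -- Both `i` and its conjugate by `g` invert the normal subgroup `A`, so their product centralizes
  -- it.
  have hiD (g : G) : g⁻¹ * (i * g * i) ∈ D := by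
    intro a ha
    have h1 := hAinv _ (hAnormal.conj_mem _ (A.inv_mem ha) g)
    have h2 : i * (g * a⁻¹ * g⁻¹) = g * a * g⁻¹ * i := by
      rw [← mul_one (i * _), ← hi, ← mul_assoc, h1]
      simp [mul_assoc]
    have h3 : i * a = a⁻¹ * i := by
      rw [← hAinv a ha, mul_assoc, hi, mul_one]
    symm
    calc g⁻¹ * (i * g * i) * a = g⁻¹ * (i * g * (i * a)) := by simp only [mul_assoc]
      _ = g⁻¹ * (i * (g * a⁻¹ * g⁻¹) * g * i) := by rw [h3]; simp [mul_assoc]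
      _ = a * (g⁻¹ * (i * g * i)) := by rw [h2]; simp [mul_assoc]
  obtain ⟨B, hBD, hBdef, hBconn, hBi⟩ := hG.exists_connected_finite_index hDdef
  have hBnormal : B.Normal := hG.normal_of_connected_finite_index hBD hBdef hBconn hBi
  have hBC : B ⊓ C = ⊥ := le_bot_iff.1 (hDC ▸ inf_le_inf_right C hBD)
  have hBinv (b : G) (hb : b ∈ B) : i * b * i = b⁻¹ :=
    hG.conj_eq_inv_of_finite hBdef hBconn hi (hstab B hBnormal)
      (hC.finite_commuting hBC hiC hi1) hb
  obtain ⟨R⟩ := hG.exists_rank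
  have hTdef : IsDefinableSubgroup L (⊤ : Subgroup G) := Set.definable_univ
  have hNdef := hG.definable_normalizer hCdef
  have hrk := hG.rank_le_of_commutator_mem hDdef hNdef hi hiD (fun g hg =>
    hC.mem_normalizer_of_commute hiC hi1 (Subgroup.mem_centralizer_singleton_iff.1 hg).symm) R
  have hrkD := (hG.isLarge_of_relIndex_ne_zero hBdef hDdef hBi
    (IsRankedGroup.subgroup_isLarge_rank R D)).2
  have hrkN := (hG.isLarge_of_relIndex_ne_zero hCdef hNdef hC.finite_index
    (IsRankedGroup.subgroup_isLarge_rank R _)).2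
  obtain ⟨hdef, hrkBC⟩ := hG.rank_sup_of_inf_eq_bot hBdef hCdef hBC R
  -- Passing from `B` to `D` and from `C` to its normalizer does not change the rank, so `B ⊔ C` has
  -- the rank of `G`.
  have htop : B ⊔ C = ⊤ := hG.eq_of_isLarge (R := R) hdef hTdef hGconn le_top
    (RankFunction.isLarge_iff.2 ⟨⟨1, one_mem _⟩, hrkBC ▸ hrk.trans (add_le_add hrkD hrkN)⟩)
  refine ⟨B, hBdef, hBconn, ⟨⟨fun a b => Subtype.ext ?_⟩⟩, hBnormal, ?_⟩
  -- Conjugation by `i` is both an automorphism and inversion on `B`, which forces commutativity.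
  · have h1 := hBinv _ (B.mul_mem a.2 b.2)
    have h2 : i * (a * b) * i = (i * a * i) * (i * b * i) := by
      simp [mul_assoc, ← mul_assoc i i, hi]
    rw [h2, hBinv a a.2, hBinv b b.2, ← mul_inv_rev, inv_inj] at h1
    exact h1.symm
  · refine Subgroup.isComplement'_of_disjoint_and_mul_eq_univ (disjoint_iff.2 hBC) ?_
    rw [← Subgroup.normal_mul, htop, Subgroup.coe_top]
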